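/- **Setting.** Let $\mathcal F\neq\emptyset$ be a set of functions $\mathbb R\to\mathbb R$ invariant under the translations $(\zeta_yu)(x)=u(x+y)$, $y\in\mathbb R$, and let $(\varphi_t)_{t\in\mathbb R}$ be a flow on $\mathcal F$ ($\varphi_0=\mathrm{id}$, $\varphi_{s+t}=\varphi_s\varphi_t$) commuting with all $\zeta_y$. For every window $\Lambda=[a,b]$, $a<b$, let $d_\Lambda$ be a metric on the set $\mathcal F|_\Lambda$ of restrictions of elements of $\mathcal F$ to $\Lambda$, such that $d_{\Lambda'}\le d_\Lambda$ if $\Lambda'\subset\Lambda$, $d_{\Lambda+y}(f,g)=d_\Lambda(\zeta_yf,\zeta_yg)$, and $\mathcal F$ is the projective limit of the $\mathcal F|_\Lambda$: a function all of whose restrictions to windows belong to the sets $\mathcal F|_\Lambda$ is in $\mathcal F$. Give $\mathcal F$ the projective limit topology (generated by the $d_\Lambda$-balls, for all $\Lambda$) and its Borel $\sigma$-algebra. Assume: * (A1) every $\mathcal F|_\Lambda$ is compact; * (A2) there is an integer $q$ such that for all $\varepsilon>0$, all adjacent windows $\Lambda_1=[a,b]$, $\Lambda_2=[b,c]$ and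 all balls $B_i\subset\mathcal F|_{\Lambda_i}$ of radius $<\varepsilon$, the set of $g\in\mathcal F|_{[a,c]}$ with $g|_{\Lambda_1}\in B_1$, $g|_{\Lambda_2}\in B_2$ is covered by $q$ balls of $\mathcal F|_{[a,c]}$ of radius $<\varepsilon$; * (A3) there are $\gamma>0$, $\Gamma>1$, $C>0$ such that whenever $\varepsilon>0$, $b-a>2C\varepsilon^{-1}$, $d_{[a,b]}(f,g)<\varepsilon$ and $0<t<C^{-1}(b-a)\varepsilon$, one has, with $\delta=C\varepsilon^{-1}(t+1)$, $d_{[a+\delta,b-\delta]}(\varphi_tf,\varphi_tg)<\Gamma e^{\gamma t}\varepsilon$, provided $a+\delta<b-\delta$. **Complexity function.** Let $K$ assign a number $K(s)\ge0$ to every finite word $s$ over every finite alphabet $\mathcal A=\{1,\dots,r\}$, such that (with $\log=\log_2$, and $O(\log n)$ standing for a term at most $c\,(1+\log(n+1))$): * (H1) for each alphabet, $K(u)\le K(uv)+O(\log|u|)$ with a constant independent of $u,v$, and $K(uv)\le K(u)+K(v)+h(|u|)+h(|v|)$ for some $h\ge0$ with $h(n)/n\to0$; * (H2) if $\pi=(\pi_1,\pi_2)$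 maps an alphabet with $qr_1r_2$ letters ($q\ge1$) onto a product of alphabets with $r_1$ and $r_2$ letters, each pair having exactly $q$ preimages, then for all words $s$: $K(\pi_i(s))\le K(s)+\mathrm{const}$ and $K(s)\le K(\pi_1(s))+K(\pi_2(s))+|s|\log q+O(\log|s|)$, with constants independent of $s$; * (H3) if $E\subset\mathcal A^*\times\mathbb N$ is recursively enumerable and all $L_n=\{s:(s,n)\in E\}$ are finite, then $K(s)\le\log\mathrm{card}(L_n)+O(\log n)$ for all $n$ and $s\in L_n$, with a constant depending only on $E$; * (H4) $\mathrm{card}\{s\in\mathcal A^*:K(s)<c\}\le2^c$ for every alphabet $\mathcal A$ and all $c\in\mathbb R$. **Complexity of a measure.** Fix a time step $\tau>0$ and an admissible sequence of windows $\Lambda_k=[a_k,b_k]$, that is, $a_k<b_k$, $b_k-a_k\to\infty$, $\liminf_k\frac{b_k-a_k}{\max\{a_k,0\}}>0$ and $\liminf_k\frac{b_k-a_k}{-\min\{b_k,0\}}>0$ (a quotient with denominator $0$ being $+\infty$). For a finite covering $\mathcal U=\{U_1,\dots,U_r\}$ of $\mathcal F|_\Lambda$ by balls of radius $<\varepsilon$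 let $K(f,\tau,\mathcal U,n)$ be the minimum of $K(\omega)$ over the words $\omega=\omega_0\cdots\omega_{n-1}\in\{1,\dots,r\}^n$ with $\varphi_{j\tau}(f)|_\Lambda\in U_{\omega_j}$ for $0\le j<n$. Put $$K(f,\tau,\varepsilon,\Lambda)=\inf_{\mathcal U}\limsup_{n\to\infty}\frac{K(f,\tau,\mathcal U,n)}n,\qquad K(f,\tau,\varepsilon)=\limsup_{k\to\infty}\frac{K(f,\tau,\varepsilon,\Lambda_k)}{|\Lambda_k|},$$ and, for a probability measure $\mu$ on $\mathcal F$ invariant under all $\zeta_y$ and $\varphi_t$, $$K_\mu=\frac1\tau\lim_{\varepsilon\searrow0}\int_{\mathcal F}K(f,\tau,\varepsilon)\,d\mu(f)\in[0,\infty].$$ **Topological entropy.** Let $N^\varepsilon_\Lambda(T)$ be the maximal cardinality of a subset of $\mathcal F$ such that for any two distinct elements $f,g$ there is $t\in(0,T)$ with $d_\Lambda(\varphi_tf,\varphi_tg)\ge\varepsilon$, and let $$\overline h_{top}=\lim_{\varepsilon\searrow0}\limsup_{|\Lambda|\to\infty}\frac1{|\Lambda|}\limsup_{T\to\infty}\frac{\log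 N^\varepsilon_\Lambda(T)}T,\qquad \underline h_{top}=\lim_{\varepsilon\searrow0}\liminf_{|\Lambda|\to\infty}\frac1{|\Lambda|}\liminf_{T\to\infty}\frac{\log N^\varepsilon_\Lambda(T)}T .$$ **Theorem.** For every $\tau>0$ and every admissible sequence of windows, $$\sup\{K_\mu:\mu\text{ a }(\zeta,\varphi)\text{-invariant probability measure on }\mathcal F\}=\overline h_{top}=\underline h_{top}$$ in $[0,\infty]$; the common value of $\overline h_{top}$ and $\underline h_{top}$ is the topological entropy per unit time and volume $h_{top}$. -/

import Mathlib

open Set Filter Topology MeasureTheory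
open scoped ENNReal NNReal

noncomputable section

/-- A spatially extended system: a translation invariant set `F` of real functions on the line,
with a flow commuting with space translations and, on every window `[a, b]` with `a < b`, a metric
`d a b` on the set of restrictions of elements of `F` to `[a, b]`. A metric on the restrictions is
written as a function of two elements of `F` that vanishes exactly when their restrictions agree.
The windows form a projective system (restriction to a smaller window does not increase distances)
whose projective limit is `F`. -/
structure ExtendedSystem where
  F : Set (ℝ → ℝ)
  nonempty : F.Nonempty
  shift_mem : ∀ f ∈ F, ∀ y : ℝ, (fun x => f (x + y)) ∈ F
  flow : ℝ → F → F
  flow_zero : ∀ f, flow 0 f = f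
  flow_add : ∀ s t f, flow (s + t) f = flow s (flow t f)
  flow_shift : ∀ (t y : ℝ) (f : F),
    flow t ⟨fun x => f.1 (x + y), shift_mem f.1 f.2 y⟩ =
      ⟨fun x => (flow t f).1 (x + y), shift_mem (flow t f).1 (flow t f).2 y⟩
  d : ℝ → ℝ → F → F → ℝ
  d_eq_zero : ∀ a b, a < b → ∀ f g, d a b f g = 0 ↔ EqOn f.1 g.1 (Icc a b)
  d_symm : ∀ a b, a < b → ∀ f g, d a b f g = d a b g f
  d_triangle : ∀ a b, a < b → ∀ f g k, d a b f k ≤ d a b f g + d a b g k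
  d_mono : ∀ a b a' b', a ≤ a' → a' < b' → b' ≤ b → ∀ f g, d a' b' f g ≤ d a b f g
  d_shift : ∀ a b, a < b → ∀ (y : ℝ) (f g : F),
    d (a + y) (b + y) f g =
      d a b ⟨fun x => f.1 (x + y), shift_mem f.1 f.2 y⟩
        ⟨fun x => g.1 (x + y), shift_mem g.1 g.2 y⟩
  mem_of_windows : ∀ f : ℝ → ℝ, (∀ a b, a < b → ∃ g ∈ F, EqOn f g (Icc a b)) → f ∈ F

namespace ExtendedSystem

/-- The phase space, as a type of its own so that it carries the projective limit topology and not
the one induced by pointwise convergence. -/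
def State (S : ExtendedSystem) : Type := S.F

variable (S : ExtendedSystem)

/-- Space translation `(ζ_y u)(x) = u(x + y)`. -/
def ζ (y : ℝ) (f : S.State) : S.State := ⟨fun x => f.1 (x + y), S.shift_mem f.1 f.2 y⟩

/-- Time evolution. -/
def φ (t : ℝ) (f : S.State) : S.State := S.flow t f

/-- The distance of the restrictions of `f` and `g` to `[a, b]`. -/
def wdist (a b : ℝ) (f g : S.State) : ℝ := S.d a b f g

/-- The window metric as a pseudometric on the phase space. -/
@[reducible] def windowMetric (a b : ℝ) (hab : a < b) : PseudoMetricSpace S.State where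
  dist := S.wdist a b
  dist_self f := (S.d_eq_zero a b hab f f).2 fun _ _ => rfl
  dist_comm := S.d_symm a b hab
  dist_triangle := S.d_triangle a b hab

/-- The projective limit topology: generated by all balls in all windows. -/
instance : TopologicalSpace S.State :=
  TopologicalSpace.generateFrom
    {B | ∃ (a b : ℝ) (f : S.State) (r : ℝ), a < b ∧ B = {g | S.wdist a b g f < r}}

instance : MeasurableSpace S.State := borel S.State

/-- The restriction of the phase space to any bounded window is compact. -/
def WindowsCompact : Prop :=
  ∀ (a b : ℝ) (hab : a < b),
    @CompactSpace S.State (S.windowMetric a b hab).toUniformSpace.toTopologicalSpace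

/-- There is an integer `q` such that, for adjacent windows, the functions lying in a ball of radius
`< ε` over the first window and in a ball of radius `< ε` over the second one are covered by `q`
balls of radius `< ε` over the union of the windows. -/
def BallsGlue : Prop :=
  ∃ q : ℕ, ∀ ε : ℝ, 0 < ε → ∀ a b c : ℝ, a < b → b < c →
    ∀ (f₁ f₂ : S.State) (r₁ r₂ : ℝ), 0 < r₁ → r₁ < ε → 0 < r₂ → r₂ < ε →
      ∃ (z : Fin q → S.State) (ρ : Fin q → ℝ), (∀ i, 0 < ρ i ∧ ρ i < ε) ∧
        ∀ g : S.State, S.wdist a b g f₁ < r₁ → S.wdist b c g f₂ < r₂ →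
          ∃ i, S.wdist a c g (z i) < ρ i

/-- Bound on the speed of separation: nearby functions in a window separate at most exponentially,
in the window deprived of the points at distance `< C ε⁻¹ (t + 1)` from its boundary. The last
hypothesis says that what is left of the window is a nondegenerate interval. -/
def SeparationBound : Prop :=
  ∃ γ Γ C : ℝ, 0 < γ ∧ 1 < Γ ∧ 0 < C ∧
    ∀ a b ε : ℝ, 0 < ε → 2 * C * ε⁻¹ < b - a →
      ∀ f g : S.State, S.wdist a b f g < ε →
        ∀ t : ℝ, 0 < t → t < C⁻¹ * (b - a) * ε →
          a + C * ε⁻¹ * (t + 1) < b - C * ε⁻¹ * (t + 1) →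
            S.wdist (a + C * ε⁻¹ * (t + 1)) (b - C * ε⁻¹ * (t + 1)) (S.φ t f) (S.φ t g)
              < Γ * Real.exp (γ * t) * ε

/-! ### Topological entropy per unit time and volume -/

/-- `f` and `g` have `([a, b], T, ε)`-indistinguishable orbits. -/
def Indistinguishable (a b T ε : ℝ) (f g : S.State) : Prop :=
  ∀ t ∈ Ioo 0 T, S.wdist a b (S.φ t f) (S.φ t g) < ε

/-- The maximal cardinality of a set of pairwise `([a, b], T, ε)`-distinguishable orbits. -/
def maxOrbits (a b T ε : ℝ) : ℕ∞ :=
  ⨆ (A : Set S.State) (_ : A.Pairwise fun f g => ¬ S.Indistinguishable a b T ε f g), A.encard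

/-- Base two logarithm of a (possibly infinite) cardinality. -/
def _root_.log₂card (N : ℕ∞) : ℝ≥0∞ :=
  if N = ⊤ then ⊤ else ENNReal.ofReal (Real.logb 2 N.toNat)

/-- `|Λ| → ∞` for windows `Λ = [a, b]`, encoded as pairs `(a, b)`. -/
def _root_.windowsToInfinity : Filter (ℝ × ℝ) := comap (fun Λ => Λ.2 - Λ.1) atTop

/-- Topological entropy per unit time and volume, with upper limits in time and space. The quantity
decreases with `ε`, so its limit as `ε → 0` is the supremum. -/
def upperTopEntropy : ℝ≥0∞ :=
  ⨆ (ε : ℝ) (_ : 0 < ε),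
    limsup (fun Λ : ℝ × ℝ =>
      limsup (fun T : ℝ => log₂card (S.maxOrbits Λ.1 Λ.2 T ε) / ENNReal.ofReal T) atTop
        / ENNReal.ofReal (Λ.2 - Λ.1)) windowsToInfinity

/-- Topological entropy per unit time and volume, with lower limits in time and space. -/
def lowerTopEntropy : ℝ≥0∞ :=
  ⨆ (ε : ℝ) (_ : 0 < ε),
    liminf (fun Λ : ℝ × ℝ =>
      liminf (fun T : ℝ => log₂card (S.maxOrbits Λ.1 Λ.2 T ε) / ENNReal.ofReal T) atTop
        / ENNReal.ofReal (Λ.2 - Λ.1)) windowsToInfinity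

/-- Invariance of a measure under all space translations and under the flow. -/
structure IsInvariant (μ : Measure S.State) : Prop where
  shift : ∀ y, MeasurePreserving (S.ζ y) μ μ
  flow : ∀ t, MeasurePreserving (S.φ t) μ μ

end ExtendedSystem

/-! ### Complexity functions -/

/-- A function assigning a nonnegative number to every finite word over every finite alphabet; the
alphabet with `r` letters is `Fin r`. -/
abbrev ComplexityFunction : Type := (r : ℕ) → List (Fin r) → ℝ≥0

namespace ComplexityFunction

variable (K : ComplexityFunction)

/-- A logarithmic error term `O(log n)`. -/
def logError (c : ℝ) (n : ℕ) : ℝ := c * (1 + Real.logb 2 (n + 1))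

/-- Behaviour on initial subwords, and subadditivity under concatenation. -/
structure Concat : Prop where
  prefix_le : ∀ r : ℕ, ∃ c : ℝ, ∀ u v : List (Fin r),
    (K r u : ℝ) ≤ K r (u ++ v) + logError c u.length
  append_le : ∀ r : ℕ, ∃ h : ℕ → ℝ≥0, Tendsto (fun n : ℕ => (h n : ℝ) / n) atTop (𝓝 0) ∧
    ∀ u v : List (Fin r), K r (u ++ v) ≤ K r u + K r v + h u.length + h v.length

/-- Behaviour under projections: `π` maps an alphabet with `q r₁ r₂` letters onto the product of
two alphabets with `r₁` and `r₂` letters, every pair being the image of `q` letters. -/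
def Projection : Prop :=
  ∀ (r₁ r₂ q : ℕ) (π : Fin (q * r₁ * r₂) → Fin r₁ × Fin r₂), 1 ≤ q →
    (∀ p, {a | π a = p}.ncard = q) → ∃ c : ℝ, ∀ s : List (Fin (q * r₁ * r₂)),
      (K r₁ (s.map fun a => (π a).1) : ℝ) ≤ K _ s + c ∧
      (K r₂ (s.map fun a => (π a).2) : ℝ) ≤ K _ s + c ∧
      (K _ s : ℝ) ≤ K r₁ (s.map fun a => (π a).1) + K r₂ (s.map fun a => (π a).2)
        + s.length * Real.logb 2 q + logError c s.length

/-- Shannon-type bound over a recursively enumerable family of finite sets of words. -/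
def Shannon : Prop :=
  ∀ (r : ℕ) (E : Set (List (Fin r) × ℕ)), REPred (fun p => p ∈ E) →
    (∀ n : ℕ, {s | (s, n) ∈ E}.Finite) →
      ∃ c : ℝ, ∀ (n : ℕ) (s : List (Fin r)), (s, n) ∈ E →
        (K r s : ℝ) ≤ Real.logb 2 ({s' | (s', n) ∈ E}.ncard) + logError c n

/-- Counting bound. -/
def Counting : Prop :=
  ∀ (r : ℕ) (c : ℝ), {s : List (Fin r) | (K r s : ℝ) < c}.Finite ∧
    ({s : List (Fin r) | (K r s : ℝ) < c}.ncard : ℝ) ≤ (2 : ℝ) ^ c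

end ComplexityFunction

/-! ### Complexity per unit time and volume -/

namespace ExtendedSystem

variable (S : ExtendedSystem)

/-- A finite covering of the restrictions to `[a, b]` by balls of radius `< ε`. -/
structure Covering (a b ε : ℝ) where
  card : ℕ
  center : Fin card → S.State
  radius : Fin card → ℝ
  radius_pos : ∀ i, 0 < radius i
  radius_lt : ∀ i, radius i < ε
  covers : ∀ f, ∃ i, S.wdist a b f (center i) < radius i

variable {S}

/-- `ω` is a symbolic coding of the first `n` points of the orbit of `f` with time step `τ`. -/
def Covering.Codes {a b ε : ℝ} (U : S.Covering a b ε) (τ : ℝ) (f : S.State) (n : ℕ)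
    (ω : Fin n → Fin U.card) : Prop :=
  ∀ j : Fin n, S.wdist a b (S.φ (j * τ) f) (U.center (ω j)) < U.radius (ω j)

/-- Minimal complexity of a coding of the first `n` points of the orbit of `f`. -/
def Covering.orbitComplexity {a b ε : ℝ} (U : S.Covering a b ε) (K : ComplexityFunction) (τ : ℝ)
    (f : S.State) (n : ℕ) : ℝ≥0∞ :=
  ⨅ (ω : Fin n → Fin U.card) (_ : U.Codes τ f n ω), (K U.card (List.ofFn ω) : ℝ≥0∞)

/-- Complexity of the orbit of `f` per time step, for a given covering (the upper limit, which is
the limit wherever the limit exists). -/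
def Covering.rate {a b ε : ℝ} (U : S.Covering a b ε) (K : ComplexityFunction) (τ : ℝ)
    (f : S.State) : ℝ≥0∞ :=
  limsup (fun n : ℕ => U.orbitComplexity K τ f n / n) atTop

variable (S)

/-- Complexity of the orbit of `f` per time step in the window `[a, b]` at precision `ε`. -/
def windowComplexity (K : ComplexityFunction) (τ ε a b : ℝ) (f : S.State) : ℝ≥0∞ :=
  ⨅ U : S.Covering a b ε, U.rate K τ f

/-- Admissible sequences of windows `[a k, b k]`: the lengths tend to infinity and the windows do
not move too fast to the right or to the left. Note that `ENNReal.ofReal x` is `max x 0` and that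
the quotients are infinite where the denominator vanishes. -/
structure _root_.AdmissibleWindows (a b : ℕ → ℝ) : Prop where
  lt : ∀ k, a k < b k
  length : Tendsto (fun k => b k - a k) atTop atTop
  right : 0 < liminf (fun k => ENNReal.ofReal (b k - a k) / ENNReal.ofReal (a k)) atTop
  left : 0 < liminf (fun k => ENNReal.ofReal (b k - a k) / ENNReal.ofReal (-b k)) atTop

/-- Complexity per time step and unit volume of the orbit of `f` along the windows
`[a k, b k]`. -/
def pointComplexity (K : ComplexityFunction) (τ ε : ℝ) (a b : ℕ → ℝ) (f : S.State) : ℝ≥0∞ :=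
  limsup (fun k => S.windowComplexity K τ ε (a k) (b k) f / ENNReal.ofReal (b k - a k)) atTop

/-- Complexity `K_μ` per unit time and volume of an invariant measure, computed with time step `τ`
along the windows `[a k, b k]`: the mean of the complexity of the orbits, in the limit `ε → 0`
(a supremum, as coarser precision gives smaller complexity), divided by `τ`. -/
def measureComplexity (K : ComplexityFunction) (τ : ℝ) (a b : ℕ → ℝ) (μ : Measure S.State) :
    ℝ≥0∞ :=
  (⨆ (ε : ℝ) (_ : 0 < ε), ∫⁻ f, S.pointComplexity K τ ε a b f ∂μ) / ENNReal.ofReal τ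

end ExtendedSystem

end

/-! The supremum lies below the lower entropy and above the upper one, so all three quantities
agree.

Upper bound, for each orbit separately. If the lower entropy is below `c`, some window of large
length `L` and some long time have a maximal separated set whose logarithm is less than `c` times
length times time. This set gives `M` strings of `n` balls that follow every orbit for `n` steps.
Gluing along `P` translates of the window yields `(M * q ^ n) ^ P` strings over a window of length
`P * L`. An orbit of any duration is then a concatenation of blocks, each chosen among that many
words, and (H3) bounds its complexity by the number of blocks times the logarithm of the number of
choices (`HasStringCover.windowComplexity_le`). The gluing contributes `log q / L` per unit length,
which disappears as `L` grows.

Lower bound. If `c` is below the upper entropy, there are separated sets `E` over large space-time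
boxes with `log |E|` at least `c` times the volume. Means over `E` and over lattice translations in
the box have an ultralimit; averaging it with an invariant mean on the group of translations and
applying Riesz's theorem gives an invariant measure `μ`. Suppose that all orbits can be coded over a
tile of `L` by `n` at cost at most `G`, with Kraft sum `Z`. Coding `E` by arrays of tiles must
distinguish its elements, so Jensen's inequality bounds the total cost from below; averaging over
the positions of the array turns this into `∫ G dμ ≥ cτLn - log Z - n log q` for continuous `G`
(`exists_invariant_measure_cost_le`).

The costs of interest are complexities of words over finitely many coverings. By (H3) and (H4) their
Kraft sum is at most linear in `n`, so `log Z` is negligible. Complexity is not continuous in the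
orbit, hence `smoothCost`, a continuous minorant that still pays for a coding by balls of doubled
radius. The integral bound then passes to `n → ∞` by the reverse Fatou lemma, to all coverings by
reduction to a countable family and monotone convergence, and to `L → ∞` by reverse Fatou again. -/

namespace ExtendedSystem

variable {S : ExtendedSystem}

/-! ### Window distances -/

theorem wdist_self {a b : ℝ} (hab : a < b) (f : S.State) : S.wdist a b f f = 0 :=
  (S.windowMetric a b hab).dist_self f

theorem wdist_comm {a b : ℝ} (hab : a < b) (f g : S.State) : S.wdist a b f g = S.wdist a b g f :=
  S.d_symm a b hab f g

theorem wdist_triangle {a b : ℝ} (hab : a < b) (f g k : S.State) :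
    S.wdist a b f k ≤ S.wdist a b f g + S.wdist a b g k :=
  S.d_triangle a b hab f g k

theorem wdist_nonneg {a b : ℝ} (hab : a < b) (f g : S.State) : 0 ≤ S.wdist a b f g :=
  @dist_nonneg _ (S.windowMetric a b hab) f g

theorem wdist_mono {a b a' b' : ℝ} (ha : a ≤ a') (h : a' < b') (hb : b' ≤ b) (f g : S.State) :
    S.wdist a' b' f g ≤ S.wdist a b f g :=
  S.d_mono a b a' b' ha h hb f g

theorem wdist_shift {a b : ℝ} (hab : a < b) (y : ℝ) (f g : S.State) :
    S.wdist a b (S.ζ y f) (S.ζ y g) = S.wdist (a + y) (b + y) f g :=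
  (S.d_shift a b hab y f g).symm

theorem ζ_zero (f : S.State) : S.ζ 0 f = f :=
  Subtype.ext (funext fun x => congrArg f.1 (add_zero x))

theorem ζ_add (y z : ℝ) (f : S.State) : S.ζ (y + z) f = S.ζ y (S.ζ z f) :=
  Subtype.ext (funext fun x => congrArg f.1 (add_assoc x y z).symm)

theorem φ_zero (f : S.State) : S.φ 0 f = f := S.flow_zero f

theorem φ_add (s t : ℝ) (f : S.State) : S.φ (s + t) f = S.φ s (S.φ t f) := S.flow_add s t f

theorem φ_ζ (t y : ℝ) (f : S.State) : S.φ t (S.ζ y f) = S.ζ y (S.φ t f) := S.flow_shift t y f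

theorem wdist_φ_ζ {a b : ℝ} (hab : a < b) (s y t : ℝ) (f z : S.State) :
    S.wdist a b (S.φ s (S.ζ y (S.φ t f))) z =
      S.wdist (a + y) (b + y) (S.φ (s + t) f) (S.ζ (-y) z) := by
  rw [φ_ζ, ← φ_add, ← wdist_shift hab, ← ζ_add, add_neg_cancel, ζ_zero]

/-! ### The projective limit topology -/

theorem isOpen_ball {a b : ℝ} (hab : a < b) (f : S.State) (r : ℝ) :
    IsOpen {g : S.State | S.wdist a b g f < r} :=
  TopologicalSpace.isOpen_generateFrom_of_mem ⟨a, b, f, r, hab, rfl⟩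

theorem eventually_wdist_lt {a b : ℝ} (hab : a < b) (f : S.State) {ε : ℝ} (hε : 0 < ε) :
    ∀ᶠ g in 𝓝 f, S.wdist a b g f < ε :=
  (isOpen_ball hab f ε).mem_nhds (show S.wdist a b f f < ε by rwa [wdist_self hab])

theorem continuous_wdist {a b : ℝ} (hab : a < b) (z : S.State) :
    Continuous fun f : S.State => S.wdist a b f z := by
  rw [continuous_iff_continuousAt]
  intro f
  rw [ContinuousAt, Metric.tendsto_nhds]
  intro ε hε
  filter_upwards [eventually_wdist_lt hab f hε] with g hg
  have h1 := wdist_triangle hab g f z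
  have h2 := wdist_triangle hab f g z
  rw [wdist_comm hab f g] at h2
  rw [Real.dist_eq, abs_lt]
  constructor <;> linarith

/-- A map into the phase space is continuous if its distance to any fixed image is small
nearby, in every window. -/
theorem continuous_of_forall_wdist {X : Type*} [TopologicalSpace X] {u : X → S.State}
    (h : ∀ a b : ℝ, a < b → ∀ x : X, ∀ ε > 0, ∀ᶠ y in 𝓝 x, S.wdist a b (u y) (u x) < ε) :
    Continuous u := by
  refine continuous_generateFrom_iff.2 ?_
  rintro _ ⟨a, b, f, r, hab, rfl⟩
  rw [isOpen_iff_mem_nhds]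
  intro x hx
  simp only [mem_preimage, mem_ofPred_eq] at hx
  filter_upwards [h a b hab x (r - S.wdist a b (u x) f) (by linarith)] with y hy
  have := wdist_triangle hab (u y) (u x) f
  simp only [mem_preimage, mem_ofPred_eq]
  linarith

theorem continuous_ζ (y : ℝ) : Continuous (S.ζ y) := by
  refine continuous_of_forall_wdist fun a b hab f ε hε => ?_
  filter_upwards [eventually_wdist_lt (by linarith : a + y < b + y) f hε] with g hg
  rw [wdist_shift hab]
  exact hg

instance : T2Space S.State := by
  refine ⟨fun f g hfg => ?_⟩
  obtain ⟨x, hx⟩ : ∃ x, f.1 x ≠ g.1 x := by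
    by_contra! h
    exact hfg (Subtype.ext (funext h))
  have hab : x - 1 < x + 1 := by linarith
  have hpos : 0 < S.wdist (x - 1) (x + 1) f g := by
    refine lt_of_le_of_ne (wdist_nonneg hab f g) fun h => hx ?_
    exact (S.d_eq_zero _ _ hab f g).1 h.symm ⟨by linarith, by linarith⟩
  refine ⟨_, _, isOpen_ball hab f (S.wdist (x - 1) (x + 1) f g / 2),
    isOpen_ball hab g (S.wdist (x - 1) (x + 1) f g / 2), ?_, ?_, ?_⟩
  · simpa [wdist_self hab] using hpos
  · simpa [wdist_self hab] using hpos
  · rw [Set.disjoint_left]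
    intro k hk hk'
    simp only [mem_ofPred_eq] at hk hk'
    have := wdist_triangle hab f k g
    rw [wdist_comm hab f k] at this
    linarith

theorem neg_succ_lt_succ (n : ℕ) : -((n : ℝ) + 1) < (n : ℝ) + 1 := by
  have : (0 : ℝ) ≤ n := n.cast_nonneg
  linarith

/-- The symmetric windows are cofinal among all windows, so countably many pseudometrics suffice.
This makes the phase space pseudometrizable, hence finite Borel measures are determined by integrals
of continuous functions. -/
theorem topology_eq_iInf :
    (inferInstance : TopologicalSpace S.State) =
      ⨅ n : ℕ, (S.windowMetric _ _ (neg_succ_lt_succ n)).toUniformSpace.toTopologicalSpace := by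
  refine le_antisymm (le_iInf fun n => ?_) ?_
  · refine continuous_id_iff_le.1 ?_
    let _ := S.windowMetric _ _ (neg_succ_lt_succ n)
    rw [Metric.continuous_iff']
    exact fun f ε hε => eventually_wdist_lt (neg_succ_lt_succ n) f hε
  · refine le_generateFrom ?_
    rintro _ ⟨a, b, f, r, hab, rfl⟩
    obtain ⟨n, hn⟩ := exists_nat_ge (max (-a) b)
    have ha : -((n : ℝ) + 1) ≤ a := by linarith [le_max_left (-a) b]
    have hb : b ≤ (n : ℝ) + 1 := by linarith [le_max_right (-a) b]
    refine (iInf_le _ n :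
      _ ≤ (S.windowMetric _ _ (neg_succ_lt_succ n)).toUniformSpace.toTopologicalSpace) _ ?_
    let _ := S.windowMetric _ _ (neg_succ_lt_succ n)
    rw [Metric.isOpen_iff]
    intro g hg
    simp only [mem_ofPred_eq] at hg
    refine ⟨r - S.wdist a b g f, by linarith, fun k hk => ?_⟩
    have h1 : S.wdist _ _ k g < r - S.wdist a b g f := hk
    have h2 := wdist_mono ha hab hb k g
    have h3 := wdist_triangle hab k g f
    simp only [mem_ofPred_eq]
    linarith

instance : TopologicalSpace.PseudoMetrizableSpace S.State := by
  have key : @TopologicalSpace.PseudoMetrizableSpace S.State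
      (⨅ n : ℕ, (S.windowMetric _ _ (neg_succ_lt_succ n)).toUniformSpace).toTopologicalSpace := by
    let _ : UniformSpace S.State :=
      ⨅ n : ℕ, (S.windowMetric _ _ (neg_succ_lt_succ n)).toUniformSpace
    have : IsCountablyGenerated (uniformity S.State) := by
      rw [iInf_uniformity]
      have (n : ℕ) : IsCountablyGenerated (@uniformity S.State
          (S.windowMetric _ _ (neg_succ_lt_succ n)).toUniformSpace) :=
        @EMetric.instIsCountablyGeneratedUniformity S.State
          (S.windowMetric _ _ (neg_succ_lt_succ n)).toPseudoEMetricSpace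
      exact Filter.iInf.isCountablyGenerated _
    exact UniformSpace.pseudoMetrizableSpace
  rw [UniformSpace.toTopologicalSpace_iInf, ← topology_eq_iInf] at key
  exact key

instance : BorelSpace S.State := ⟨rfl⟩

/-- The phase space is compact if the restrictions to all windows are. -/
theorem compactSpace (hA1 : S.WindowsCompact) : CompactSpace S.State := by
  refine ⟨isCompact_iff_ultrafilter_le_nhds.2 fun u _ => ?_⟩
  have hlim : ∀ n : ℕ, ∃ f : S.State, ∀ ε > 0,
      ∀ᶠ g in (u : Filter S.State), S.wdist (-((n : ℝ) + 1)) (n + 1) g f < ε := by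
    intro n
    obtain ⟨f, -, hf⟩ := @IsCompact.ultrafilter_le_nhds _
      (S.windowMetric _ _ (neg_succ_lt_succ n)).toUniformSpace.toTopologicalSpace _
      (hA1 _ _ (neg_succ_lt_succ n)).isCompact_univ u (by simp)
    exact ⟨f, fun ε hε =>
      hf (@Metric.ball_mem_nhds _ (S.windowMetric _ _ (neg_succ_lt_succ n)) f ε hε)⟩
  choose F hF using hlim
  have hagree : ∀ n m : ℕ, n ≤ m → EqOn (F n).1 (F m).1 (Icc (-((n : ℝ) + 1)) (n + 1)) := by
    intro n m hnm
    have hnm' : (n : ℝ) ≤ m := by exact_mod_cast hnm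
    refine (S.d_eq_zero _ _ (neg_succ_lt_succ n) _ _).1 ?_
    refine le_antisymm (le_of_forall_pos_le_add fun ε hε => ?_)
      (wdist_nonneg (neg_succ_lt_succ n) _ _)
    obtain ⟨g, hg, hg'⟩ := ((hF n (ε / 2) (by linarith)).and (hF m (ε / 2) (by linarith))).exists
    have h1 := wdist_triangle (neg_succ_lt_succ n) (F n) g (F m)
    have h2 := wdist_mono (by linarith : -((m : ℝ) + 1) ≤ -((n : ℝ) + 1)) (neg_succ_lt_succ n)
      (by linarith : (n : ℝ) + 1 ≤ m + 1) g (F m)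
    rw [wdist_comm (neg_succ_lt_succ n) (F n) g] at h1
    change S.wdist _ _ (F n) (F m) ≤ 0 + ε
    linarith
  -- The limits in the various windows agree on overlaps and paste to one function; the index
  -- `⌈|x|⌉₊` selects a window containing `x`. The projective limit property puts the result in `F`.
  let f : ℝ → ℝ := fun x => (F ⌈|x|⌉₊).1 x
  have hf : ∀ n : ℕ, EqOn f (F n).1 (Icc (-((n : ℝ) + 1)) (n + 1)) := by
    intro n x hx
    have hx1 := Nat.le_ceil |x|
    rcases le_total n ⌈|x|⌉₊ with h | h
    · exact (hagree n _ h hx).symm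
    · exact hagree _ n h ⟨by linarith [neg_abs_le x], by linarith [le_abs_self x]⟩
  have hbig : ∀ a b : ℝ, ∃ n : ℕ, -((n : ℝ) + 1) ≤ a ∧ b ≤ (n : ℝ) + 1 := fun a b => by
    obtain ⟨n, hn⟩ := exists_nat_ge (max (-a) b)
    exact ⟨n, by linarith [le_max_left (-a) b], by linarith [le_max_right (-a) b]⟩
  have hfF : f ∈ S.F := by
    refine S.mem_of_windows f fun a b hab => ?_
    obtain ⟨n, ha, hb⟩ := hbig a b
    exact ⟨(F n).1, (F n).2, (hf n).mono (Icc_subset_Icc ha hb)⟩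
  refine ⟨⟨f, hfF⟩, mem_univ _, ?_⟩
  refine TopologicalSpace.nhds_generateFrom (α := S.State) ▸ le_iInf₂ fun B hB => ?_
  obtain ⟨hfB, a, b, z, r, hab, rfl⟩ := hB
  obtain ⟨n, ha, hb⟩ := hbig a b
  rw [le_principal_iff]
  filter_upwards [hF n (r - S.wdist a b ⟨f, hfF⟩ z) (sub_pos.2 hfB)] with g hg
  have h0 : S.wdist a b (F n) ⟨f, hfF⟩ = 0 :=
    (S.d_eq_zero _ _ hab _ _).2 fun x hx => (hf n ⟨ha.trans hx.1, hx.2.trans hb⟩).symm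
  have h1 := wdist_mono ha hab hb g (F n)
  have h2 := wdist_triangle hab g (F n) z
  have h3 := wdist_triangle hab (F n) ⟨f, hfF⟩ z
  change S.wdist a b g z < r
  linarith

/-! ### Continuity of the flow -/

theorem SeparationBound.continuous_of_pos (hA3 : S.SeparationBound) {t : ℝ} (ht : 0 < t) :
    Continuous (S.φ t) := by
  obtain ⟨γ, Γ, C, hγ, hΓ, hC, H⟩ := hA3
  refine continuous_of_forall_wdist fun a b hab f ε hε => ?_
  set A := Γ * Real.exp (γ * t) with hA
  have hApos : 0 < A := by positivity
  -- The precision `η` compensates the growth factor of (A3), and the window is enlarged by exactly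
  -- the `δ` that (A3) removes at each end.
  set η := ε / A with hη
  have hηpos : 0 < η := by positivity
  set δ := C * η⁻¹ * (t + 1) with hδ
  have hδpos : 0 < δ := by positivity
  have hCη : 0 < C * η⁻¹ := by positivity
  have hlt : a - δ < b + δ := by linarith
  filter_upwards [eventually_wdist_lt hlt f hηpos] with g hg
  have h1 : 2 * C * η⁻¹ < b + δ - (a - δ) := by
    have : C * η⁻¹ ≤ δ := by rw [hδ]; nlinarith
    linarith
  have h2 : t < C⁻¹ * (b + δ - (a - δ)) * η := by
    have h3 : C⁻¹ * (2 * δ) * η = 2 * (t + 1) := by rw [hδ]; field_simp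
    have h4 : C⁻¹ * (b + δ - (a - δ)) * η = C⁻¹ * (2 * δ) * η + C⁻¹ * (b - a) * η := by ring
    have h5 : 0 < C⁻¹ * (b - a) * η := by
      have : 0 < b - a := by linarith
      positivity
    linarith
  have h3 := H (a - δ) (b + δ) η hηpos h1 g f hg t ht h2 (by rw [← hδ]; linarith)
  rw [← hδ, sub_add_cancel, add_sub_cancel_right] at h3
  calc _ < A * η := h3
    _ = ε := by rw [hη]; field_simp

/-- The separation bound controls positive times only. For negative times `φ t` is the inverse of a
continuous bijection of a compact Hausdorff space. -/
theorem SeparationBound.continuous_φ (hA1 : S.WindowsCompact) (hA3 : S.SeparationBound) (t : ℝ) :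
    Continuous (S.φ t) := by
  have := compactSpace hA1
  rcases lt_trichotomy t 0 with ht | rfl | ht
  · let e : S.State ≃ S.State :=
      { toFun := S.φ (-t)
        invFun := S.φ t
        left_inv := fun f => by rw [← φ_add, add_neg_cancel, φ_zero]
        right_inv := fun f => by rw [← φ_add, neg_add_cancel, φ_zero] }
    have he : Continuous e := hA3.continuous_of_pos (neg_pos.2 ht)
    exact (Continuous.homeoOfEquivCompactToT2 he).symm.continuous
  · have : S.φ 0 = id := funext φ_zero
    rw [this]; exact continuous_id
  · exact hA3.continuous_of_pos ht

end ExtendedSystem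

namespace ExtendedSystem

variable {S : ExtendedSystem}

/-! ### Gluing of balls over adjacent windows -/

variable (S) in
/-- Two balls over adjacent windows are covered by `q` balls over the union of the windows. -/
def GluesWith (q : ℕ) : Prop :=
  ∀ ε : ℝ, 0 < ε → ∀ a b c : ℝ, a < b → b < c →
    ∀ (f₁ f₂ : S.State) (r₁ r₂ : ℝ), 0 < r₁ → r₁ < ε → 0 < r₂ → r₂ < ε →
      ∃ (z : Fin q → S.State) (ρ : Fin q → ℝ), (∀ i, 0 < ρ i ∧ ρ i < ε) ∧
        ∀ g : S.State, S.wdist a b g f₁ < r₁ → S.wdist b c g f₂ < r₂ →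
          ∃ i, S.wdist a c g (z i) < ρ i

theorem BallsGlue.exists_gluesWith (hA2 : S.BallsGlue) : ∃ q, 0 < q ∧ S.GluesWith q := by
  obtain ⟨q, hq⟩ := hA2
  refine ⟨q, Nat.pos_of_ne_zero ?_, hq⟩
  rintro rfl
  obtain ⟨f⟩ : Nonempty S.State := S.nonempty.to_subtype
  obtain ⟨z, ρ, -, h⟩ := hq 2 two_pos 0 1 2 one_pos one_lt_two f f 1 1 one_pos one_lt_two
    one_pos one_lt_two
  obtain ⟨i, -⟩ := h f (by rw [wdist_self one_pos]; exact one_pos)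
    (by rw [wdist_self one_lt_two]; exact one_pos)
  exact i.elim0

/-- Balls over `P` consecutive windows are covered by `q ^ P` balls over their union. -/
theorem GluesWith.consecutive {q : ℕ} (hq : S.GluesWith q) (hq0 : 0 < q) {ε L : ℝ} (hε : 0 < ε)
    (hL : 0 < L) (x : ℝ) (z : ℕ → S.State) (ρ : ℕ → ℝ) (hρ : ∀ p, 0 < ρ p ∧ ρ p < ε) {P : ℕ}
    (hP : 1 ≤ P) :
    ∃ (w : Fin (q ^ P) → S.State) (σ : Fin (q ^ P) → ℝ), (∀ i, 0 < σ i ∧ σ i < ε) ∧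
      ∀ g : S.State, (∀ p < P, S.wdist (x + p * L) (x + (p + 1) * L) g (z p) < ρ p) →
        ∃ i, S.wdist x (x + P * L) g (w i) < σ i := by
  induction P, hP using Nat.le_induction with
  | base =>
    refine ⟨fun _ => z 0, fun _ => ρ 0, fun _ => hρ 0, fun g hg => ⟨⟨0, by simpa using hq0⟩, ?_⟩⟩
    simpa using hg 0 one_pos
  | succ P hP ih =>
    obtain ⟨w, σ, hσ, hw⟩ := ih
    have hP0 : (0 : ℝ) < P := by exact_mod_cast hP
    have h1 : x < x + P * L := by have := mul_pos hP0 hL; linarith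
    have h2 : x + P * L < x + (P + 1) * L := by linarith
    choose z' ρ' hρ' hz' using fun i => hq ε hε x (x + P * L) (x + (P + 1) * L) h1 h2
      (w i) (z P) (σ i) (ρ P) (hσ i).1 (hσ i).2 (hρ P).1 (hρ P).2
    let e : Fin (q ^ (P + 1)) ≃ Fin (q ^ P) × Fin q :=
      (finCongr (pow_succ q P)).trans finProdFinEquiv.symm
    refine ⟨fun i => z' (e i).1 (e i).2, fun i => ρ' (e i).1 (e i).2, fun i => hρ' _ _,
      fun g hg => ?_⟩
    obtain ⟨i, hi⟩ := hw g fun p hp => hg p (by omega)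
    obtain ⟨k, hk⟩ := hz' i g hi (hg P (by omega))
    refine ⟨e.symm (i, k), ?_⟩
    push_cast
    simpa using hk

/-! ### Coverings of the phase space by strings of balls -/

variable (S) in
/-- The phase space is covered by `M` strings of `n` balls of radius `< ε` over `[a, b]`, to be
visited at the times `0, τ, …, (n - 1) τ`. -/
def HasStringCover (τ ε a b : ℝ) (n M : ℕ) : Prop :=
  ∃ (z : Fin M → ℕ → S.State) (ρ : Fin M → ℕ → ℝ), (∀ i j, 0 < ρ i j ∧ ρ i j < ε) ∧
    ∀ f, ∃ i, ∀ j < n, S.wdist a b (S.φ (j * τ) f) (z i j) < ρ i j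

theorem HasStringCover.of_fintype {τ ε a b : ℝ} {n M : ℕ} {ι : Type*} [Fintype ι]
    (hM : Fintype.card ι = M) (z : ι → ℕ → S.State) (ρ : ι → ℕ → ℝ)
    (hρ : ∀ i j, 0 < ρ i j ∧ ρ i j < ε)
    (h : ∀ f, ∃ i, ∀ j < n, S.wdist a b (S.φ (j * τ) f) (z i j) < ρ i j) :
    S.HasStringCover τ ε a b n M := by
  let e := Fintype.equivFinOfCardEq hM
  refine ⟨fun i => z (e.symm i), fun i => ρ (e.symm i), fun i => hρ _, fun f => ?_⟩
  obtain ⟨i, hi⟩ := h f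
  exact ⟨e i, by simpa using hi⟩

theorem HasStringCover.mono_window {τ ε a b a' b' : ℝ} {n M : ℕ}
    (h : S.HasStringCover τ ε a b n M) (ha : a ≤ a') (hab : a' < b') (hb : b' ≤ b) :
    S.HasStringCover τ ε a' b' n M := by
  obtain ⟨z, ρ, hρ, hz⟩ := h
  refine ⟨z, ρ, hρ, fun f => ?_⟩
  obtain ⟨i, hi⟩ := hz f
  exact ⟨i, fun j hj => (wdist_mono ha hab hb _ _).trans_lt (hi j hj)⟩

/-- Strings over a window `[a, a + L]`, glued along `P` translates of that window. -/
theorem HasStringCover.tile {q : ℕ} (hq : S.GluesWith q) (hq0 : 0 < q) {τ ε a L : ℝ} {n M : ℕ}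
    (hε : 0 < ε) (hL : 0 < L) (h : S.HasStringCover τ ε a (a + L) n M) {P : ℕ} (hP : 1 ≤ P)
    (x : ℝ) : S.HasStringCover τ ε x (x + P * L) n ((M * q ^ n) ^ P) := by
  obtain ⟨z, ρ, hρ, hz⟩ := h
  rcases Nat.eq_zero_or_pos M with rfl | hM
  · obtain ⟨f⟩ : Nonempty S.State := S.nonempty.to_subtype
    obtain ⟨i, -⟩ := hz f
    exact i.elim0
  let y : ℕ → ℝ := fun p => x + p * L - a
  -- Gluing takes data indexed by all of `ℕ`; the values at `p ≥ P` are arbitrary.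
  let ext : (Fin P → Fin M) → ℕ → Fin M := fun c p => if hp : p < P then c ⟨p, hp⟩ else ⟨0, hM⟩
  choose w σ hσ hw using fun (c : Fin P → Fin M) (j : ℕ) => hq.consecutive hq0 hε hL x
    (fun p => S.ζ (-y p) (z (ext c p) j)) (fun p => ρ (ext c p) j) (fun p => hρ _ _) hP
  -- A string over the union is a choice of one string per tile, `M ^ P` possibilities, and of one
  -- glued ball per time, `(q ^ P) ^ n` possibilities.
  refine HasStringCover.of_fintype (ι := (Fin P → Fin M) × (Fin n → Fin (q ^ P))) ?_
    (fun i j => if hj : j < n then w i.1 j (i.2 ⟨j, hj⟩) else z ⟨0, hM⟩ 0)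
    (fun i j => if hj : j < n then σ i.1 j (i.2 ⟨j, hj⟩) else ε / 2) ?_ ?_
  · simp only [Fintype.card_prod, Fintype.card_fun, Fintype.card_fin]
    rw [mul_pow, ← pow_mul, ← pow_mul, mul_comm P n]
  · intro i j
    by_cases hj : j < n
    · simpa [hj] using hσ _ _ _
    · simpa [hj] using hε
  · intro f
    choose c hc using fun p : Fin P => hz (S.ζ (y p) f)
    have hglue : ∀ j < n, ∃ k, S.wdist x (x + P * L) (S.φ (j * τ) f) (w c j k) < σ c j k := by
      intro j hj
      refine hw c j _ fun p hp => ?_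
      have h1 := hc ⟨p, hp⟩ j hj
      have h2 : ext c p = c ⟨p, hp⟩ := by simp [ext, hp]
      have h3 := wdist_φ_ζ (by linarith : a < a + L) (j * τ) (y p) 0 f (z (c ⟨p, hp⟩) j)
      rw [φ_zero, add_zero] at h3
      rw [h2]
      rw [h3] at h1
      convert h1 using 2
      · simp only [y]; ring
      · simp only [y]; ring
    choose k hk using hglue
    refine ⟨(c, fun j => k j j.2), fun j hj => ?_⟩
    simpa [hj] using hk j hj

theorem exists_hasStringCover_one (hA1 : S.WindowsCompact) (τ : ℝ) {ε a b : ℝ} (hε : 0 < ε)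
    (hab : a < b) : ∃ M, S.HasStringCover τ ε a b 1 M := by
  have := compactSpace hA1
  obtain ⟨t, ht⟩ := isCompact_univ.elim_finite_subcover
    (fun z : S.State => {g : S.State | S.wdist a b g z < ε / 2})
    (fun z => isOpen_ball hab z (ε / 2))
    (fun f _ => mem_iUnion.2 ⟨f, show S.wdist a b f f < ε / 2 by rw [wdist_self hab]; linarith⟩)
  refine ⟨_, HasStringCover.of_fintype (ι := t) rfl (fun i _ => i.1) (fun _ _ => ε / 2)
    (fun _ _ => ⟨by linarith, by linarith⟩) fun f => ?_⟩
  obtain ⟨z, hz, hf⟩ := mem_iUnion₂.1 (ht (mem_univ f))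
  refine ⟨⟨z, hz⟩, fun j hj => ?_⟩
  obtain rfl : j = 0 := by omega
  simpa [φ_zero] using hf

/-! ### Distinguishable orbits -/

theorem Indistinguishable.symm {a b T ε : ℝ} (hab : a < b) {f g : S.State}
    (h : S.Indistinguishable a b T ε f g) : S.Indistinguishable a b T ε g f :=
  fun t ht => by rw [wdist_comm hab]; exact h t ht

/-- A finite supremum of cardinalities is attained, and a maximal separated set is a net: adding a
state at no small distance from it would enlarge it. -/
theorem hasStringCover_of_maxOrbits {τ ε a b : ℝ} (hτ : 0 < τ) (hε : 0 < ε) (hab : a < b) (n : ℕ)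
    (hN : S.maxOrbits a b (n * τ) (ε / 2) ≠ ⊤) :
    S.HasStringCover τ ε a b n (S.maxOrbits a b (n * τ) (ε / 2)).toNat := by
  set T := n * τ
  obtain ⟨⟨A, hA⟩, hAN⟩ : ∃ A : {A : Set S.State //
      A.Pairwise fun f g => ¬ S.Indistinguishable a b T (ε / 2) f g},
      A.1.encard = S.maxOrbits a b T (ε / 2) := by
    have : Nonempty {A : Set S.State //
      A.Pairwise fun f g => ¬ S.Indistinguishable a b T (ε / 2) f g} := ⟨∅, pairwise_empty _⟩
    have h : S.maxOrbits a b T (ε / 2) = ⨆ A : {A : Set S.State //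
      A.Pairwise fun f g => ¬ S.Indistinguishable a b T (ε / 2) f g}, A.1.encard :=
      (iSup_subtype' (f := fun (A : Set S.State)
        (_ : A.Pairwise fun f g => ¬ S.Indistinguishable a b T (ε / 2) f g) => A.encard))
    rw [h] at hN ⊢
    exact ENat.exists_eq_iSup_of_lt_top (lt_top_iff_ne_top.2 hN)
  simp only at hAN
  have hfin : A.Finite := by
    rw [← Set.encard_ne_top_iff, hAN]; exact hN
  have hmax : ∀ f : S.State, ∃ g ∈ A, S.Indistinguishable a b T (ε / 2) f g := by
    intro f
    by_contra! hf
    have hfA : f ∉ A := fun h => hf f h fun t _ => by rw [wdist_self hab]; linarith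
    have h1 : (insert f A).encard ≤ S.maxOrbits a b T (ε / 2) := by
      refine le_iSup₂_of_le (insert f A) ?_ le_rfl
      exact hA.insert_of_notMem hfA fun g hg => ⟨hf g hg, fun h => hf g hg (h.symm hab)⟩
    rw [Set.encard_insert_of_notMem hfA, hAN] at h1
    exact (ENat.lt_add_one_iff hN).2 le_rfl |>.not_ge h1
  have := hfin.fintype
  -- Indistinguishability refers to the open interval of times and says nothing at time `0`. Orbits
  -- are therefore sampled at the midpoints `j * τ + τ / 2`, after moving `f` back by `τ / 2`.
  refine HasStringCover.of_fintype (ι := A) ?_ (fun g j => S.φ (j * τ + τ / 2) g.1)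
    (fun _ _ => ε / 2) (fun _ _ => ⟨by linarith, by linarith⟩) fun f => ?_
  · rw [← hAN, Set.encard_eq_coe_toFinset_card, ENat.toNat_natCast, Set.toFinset_card]
  · obtain ⟨g, hg, hfg⟩ := hmax (S.φ (-(τ / 2)) f)
    refine ⟨⟨g, hg⟩, fun j hj => ?_⟩
    have hj' : (j : ℝ) + 1 ≤ n := by exact_mod_cast hj
    have h1 := hfg (j * τ + τ / 2) ⟨by positivity, by simp only [T]; nlinarith⟩
    rwa [← φ_add, add_neg_cancel_right] at h1

end ExtendedSystem

theorem logb_two_natCast_nonneg (n : ℕ) : 0 ≤ Real.logb 2 n := by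
  rw [Real.logb]
  positivity

/-! ### Complexity of concatenations of blocks -/

/-- The concatenations of `n` blocks taken from a finite family of words form a recursively
enumerable set. -/
theorem rePred_flatMap {M r : ℕ} (w : Fin M → List (Fin r)) :
    REPred fun p : List (Fin r) × ℕ =>
      p ∈ {p : List (Fin r) × ℕ | ∃ v : List (Fin M), v.length = p.2 ∧ v.flatMap w = p.1} := by
  have hw : Primrec w := Primrec.dom_finite w
  have hflat : Primrec fun v : List (Fin M) => v.flatMap w :=
    Primrec.list_flatMap Primrec.id (hw.comp Primrec.snd).to₂
  have hpair : Primrec fun v : List (Fin M) => (v.flatMap w, v.length) :=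
    hflat.pair Primrec.list_length
  -- Membership is semidecided by an unbounded search over the codes of the block sequences `v`.
  have hdec : Computable fun x : (List (Fin r) × ℕ) × ℕ =>
      ((Encodable.decode x.2 : Option (List (Fin M))).map fun v => (v.flatMap w, v.length)) :=
    (Primrec.option_map (Primrec.decode.comp Primrec.snd)
      (hpair.comp Primrec.snd).to₂).to_comp
  have hbeq : Computable₂ fun (x : List (Fin r) × ℕ) (k : ℕ) =>
      decide (((Encodable.decode k : Option (List (Fin M))).map
        fun v => (v.flatMap w, v.length)) = some x) := by
    have : Primrec₂ fun a b : Option (List (Fin r) × ℕ) => decide (a = b) := Primrec.eq.decide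
    exact this.to_comp.comp hdec (Computable.option_some.comp Computable.fst)
  have hfind : Partrec fun x : List (Fin r) × ℕ => Nat.rfind fun k =>
      Part.some (decide (((Encodable.decode k : Option (List (Fin M))).map
        fun v => (v.flatMap w, v.length)) = some x)) := Partrec.rfind hbeq.partrec₂
  refine hfind.dom_re.of_eq fun x => ?_
  refine Nat.rfind_dom.trans ?_
  simp only [Part.mem_some_iff, Part.some_dom, implies_true, and_true]
  constructor
  · rintro ⟨k, hk⟩
    have hk' := of_decide_eq_true hk.symm
    rw [Option.map_eq_some_iff] at hk'
    obtain ⟨v, -, rfl⟩ := hk'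
    exact ⟨v, rfl, rfl⟩
  · rintro ⟨v, h1, h2⟩
    exact ⟨Encodable.encode v, by simp [h1, h2]⟩

namespace ComplexityFunction

variable {K : ComplexityFunction}

/-- There are at most `M ^ n` concatenations of `n` blocks, and (H3) applies to them. The bound
involves the number of blocks and not their lengths, which is why long blocks are economical. -/
theorem Shannon.flatMap_le (hH3 : K.Shannon) {M r : ℕ} (w : Fin M → List (Fin r)) :
    ∃ c : ℝ, ∀ v : List (Fin M),
      (K r (v.flatMap w) : ℝ) ≤ v.length * Real.logb 2 M + logError c v.length := by
  have hset : ∀ n : ℕ, {s | (s, n) ∈ {p : List (Fin r) × ℕ |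
      ∃ v : List (Fin M), v.length = p.2 ∧ v.flatMap w = p.1}} =
      Set.range fun u : Fin n → Fin M => (List.ofFn u).flatMap w := by
    intro n
    ext s
    constructor
    · rintro ⟨v, rfl, rfl⟩
      exact ⟨v.get, by simp [List.ofFn_get]⟩
    · rintro ⟨u, rfl⟩
      exact ⟨List.ofFn u, by simp, rfl⟩
  obtain ⟨c, hc⟩ := hH3 r _ (rePred_flatMap w) fun n => by
    rw [hset]; exact Set.finite_range _
  refine ⟨c, fun v => (hc v.length _ ⟨v, rfl, rfl⟩).trans ?_⟩
  gcongr
  rw [hset, ← Real.logb_pow]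
  have hne : (Set.range fun u : Fin v.length → Fin M => (List.ofFn u).flatMap w).Nonempty :=
    ⟨_, v.get, rfl⟩
  refine Real.logb_le_logb_of_le one_lt_two ?_ ?_
  · exact_mod_cast (Set.ncard_pos (Set.finite_range _)).2 hne
  · have h1 := Set.ncard_image_le (f := fun u : Fin v.length → Fin M => (List.ofFn u).flatMap w)
      Set.finite_univ
    rw [Set.image_univ, Set.ncard_univ, Nat.card_eq_fintype_card] at h1
    simp only [Fintype.card_fun, Fintype.card_fin] at h1
    exact_mod_cast h1

/-- The constants supplied by (H1) and (H3) may be negative, so monotonicity in `n` requires the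
absolute value. -/
theorem logError_le {c : ℝ} {m n : ℕ} (h : m ≤ n) : logError c m ≤ logError |c| n := by
  have h0 : ∀ k : ℕ, 0 ≤ Real.logb 2 ((k : ℝ) + 1) := fun k =>
    Real.logb_nonneg one_lt_two (by simp)
  have h1 : Real.logb 2 ((m : ℝ) + 1) ≤ Real.logb 2 ((n : ℝ) + 1) :=
    Real.logb_le_logb_of_le one_lt_two (by positivity) (by gcongr)
  unfold logError
  calc c * (1 + Real.logb 2 (m + 1)) ≤ |c| * (1 + Real.logb 2 (m + 1)) := by
        have := h0 m
        gcongr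
        exact le_abs_self c
    _ ≤ _ := by gcongr

theorem tendsto_logb_div : Tendsto (fun n : ℕ => Real.logb 2 ((n : ℝ) + 1) / n) atTop (𝓝 0) := by
  have h1 : Tendsto (fun x : ℝ => Real.log x / x) atTop (𝓝 0) :=
    (Real.isLittleO_log_id_atTop).tendsto_div_nhds_zero
  have h2 : Tendsto (fun n : ℕ => (n : ℝ) + 1) atTop atTop :=
    tendsto_atTop_add_const_right _ _ tendsto_natCast_atTop_atTop
  have h3 := (h1.comp h2)
  have h4 : Tendsto (fun n : ℕ => ((n : ℝ) + 1) / n) atTop (𝓝 1) := by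
    have : Tendsto (fun n : ℕ => 1 + ((n : ℝ))⁻¹) atTop (𝓝 (1 + 0)) :=
      tendsto_const_nhds.add (tendsto_inv_atTop_zero.comp tendsto_natCast_atTop_atTop)
    rw [add_zero] at this
    refine this.congr' ?_
    filter_upwards [eventually_gt_atTop 0] with n hn
    have : (n : ℝ) ≠ 0 := by positivity
    field_simp
  have h5 := (h3.mul h4).mul_const (Real.log 2)⁻¹
  simp only [zero_mul] at h5
  refine h5.congr' ?_
  filter_upwards [eventually_gt_atTop 0] with n hn
  have h6 : (n : ℝ) ≠ 0 := by positivity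
  have h7 : (n : ℝ) + 1 ≠ 0 := by positivity
  have h8 : Real.log 2 ≠ 0 := by positivity
  simp only [Function.comp, Real.logb]
  field_simp

theorem tendsto_logError_div (c : ℝ) :
    Tendsto (fun n : ℕ => logError c n / n) atTop (𝓝 0) := by
  have h1 : Tendsto (fun n : ℕ => c * (((n : ℝ))⁻¹ + Real.logb 2 ((n : ℝ) + 1) / n)) atTop
      (𝓝 (c * (0 + 0))) :=
    ((tendsto_inv_atTop_zero.comp tendsto_natCast_atTop_atTop).add tendsto_logb_div).const_mul c
  simp only [add_zero, mul_zero] at h1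
  refine h1.congr fun n => ?_
  unfold logError
  ring

/-- Words have at most linear complexity. -/
theorem Shannon.exists_linear_bound (hH3 : K.Shannon) (r : ℕ) :
    ∃ B : ℝ≥0, ∀ s : List (Fin r), (K r s : ℝ) ≤ B * (s.length + 1) := by
  obtain ⟨c, hc⟩ := hH3.flatMap_le (fun i : Fin r => [i])
  have hr : 0 ≤ Real.logb 2 r := logb_two_natCast_nonneg r
  refine ⟨⟨Real.logb 2 r + 2 * |c|, by positivity⟩, fun s => ?_⟩
  have h1 := hc s
  rw [List.flatMap_singleton'] at h1
  have h2 : logError c s.length ≤ |c| * (1 + Real.logb 2 (s.length + 1)) := logError_le le_rfl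
  have h3 : Real.logb 2 ((s.length : ℝ) + 1) ≤ s.length + 1 := by
    have h4 : (s.length : ℝ) + 1 ≤ 2 ^ (s.length + 1) := by
      have := Nat.lt_two_pow_self (n := s.length + 1)
      exact_mod_cast this.le
    calc _ ≤ Real.logb 2 (2 ^ (s.length + 1)) :=
          Real.logb_le_logb_of_le one_lt_two (by positivity) h4
      _ = s.length + 1 := by rw [Real.logb_pow, Real.logb_self_eq_one one_lt_two]; push_cast; ring
  have h5 : (0 : ℝ) ≤ s.length := by positivity
  have h6 := abs_nonneg c
  change _ ≤ (Real.logb 2 r + 2 * |c|) * _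
  nlinarith

end ComplexityFunction

namespace ExtendedSystem

variable {S : ExtendedSystem} {K : ComplexityFunction}

open ComplexityFunction

/-! ### Upper bound for the complexity of orbits -/

theorem HasStringCover.pos {τ ε a b : ℝ} {n M : ℕ} (h : S.HasStringCover τ ε a b n M) : 0 < M := by
  obtain ⟨z, ρ, -, hz⟩ := h
  obtain ⟨f⟩ : Nonempty S.State := S.nonempty.to_subtype
  obtain ⟨i, -⟩ := hz f
  exact i.pos

/-- The alphabet formed by all balls of a family of strings. -/
noncomputable def stringCovering {ε a b τ : ℝ} {n M : ℕ} (hn : 0 < n)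
    (z : Fin M → ℕ → S.State) (ρ : Fin M → ℕ → ℝ) (hρ : ∀ i j, 0 < ρ i j ∧ ρ i j < ε)
    (hz : ∀ f, ∃ i, ∀ j < n, S.wdist a b (S.φ (j * τ) f) (z i j) < ρ i j) :
    S.Covering a b ε where
  card := M * n
  center i := z (finProdFinEquiv.symm i).1 (finProdFinEquiv.symm i).2
  radius i := ρ (finProdFinEquiv.symm i).1 (finProdFinEquiv.symm i).2
  radius_pos i := (hρ _ _).1
  radius_lt i := (hρ _ _).2
  covers f := by
    obtain ⟨i, hi⟩ := hz f
    refine ⟨finProdFinEquiv (i, ⟨0, hn⟩), ?_⟩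
    simpa [φ_zero] using hi 0 hn

/-- The alphabet consists of all `M * n` balls of all strings. Cutting an orbit into pieces of `n`
steps codes it by a concatenation of blocks, each one of `M` words, so a step costs `log M / n`. -/
theorem HasStringCover.windowComplexity_le (hH1 : K.Concat) (hH3 : K.Shannon) {τ ε a b : ℝ}
    {n M : ℕ} (hn : 0 < n) (h : S.HasStringCover τ ε a b n M) (f : S.State) :
    S.windowComplexity K τ ε a b f ≤ ENNReal.ofReal (Real.logb 2 M / n) := by
  obtain ⟨z, ρ, hρ, hz⟩ := h
  let U : S.Covering a b ε := stringCovering hn z ρ hρ hz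
  refine (iInf_le _ U).trans ?_
  let w : Fin M → List (Fin (M * n)) := fun i => List.ofFn fun j : Fin n => finProdFinEquiv (i, j)
  obtain ⟨c₁, hc₁⟩ := hH1.prefix_le (M * n)
  obtain ⟨c₂, hc₂⟩ := hH3.flatMap_le w
  choose s hs using fun k : ℕ => hz (S.φ (k * n * τ) f)
  -- The letter at time `t` records the string used on the block containing `t` and the position
  -- inside that block.
  let ω : ℕ → Fin (M * n) := fun t => finProdFinEquiv (s (t / n), ⟨t % n, Nat.mod_lt _ hn⟩)
  have hcode : ∀ N : ℕ, U.Codes τ f N fun j => ω j := by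
    intro N j
    have h1 := hs (j / n) (j % n) (Nat.mod_lt _ hn)
    rw [← φ_add] at h1
    have h2 : (((j : ℕ) % n : ℕ) : ℝ) * τ + (((j : ℕ) / n : ℕ) : ℝ) * n * τ = (j : ℕ) * τ := by
      have h3 : ((n * (j / n) + j % n : ℕ) : ℝ) = (j : ℕ) := by rw [Nat.div_add_mod]
      push_cast at h3
      rw [← h3]
      ring
    rw [h2] at h1
    simpa [U, stringCovering, ω] using h1
  have hword : ∀ m : ℕ, (List.ofFn fun j : Fin (m * n) => ω j) =
      (List.ofFn fun k : Fin m => s k).flatMap w := by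
    intro m
    rw [List.ofFn_mul, List.flatMap, List.map_ofFn]
    congr 1
    refine congrArg List.ofFn (funext fun k => ?_)
    refine congrArg List.ofFn (funext fun j => ?_)
    have h1 : ((k : ℕ) * n + j) / n = k := by
      rw [mul_comm, Nat.mul_add_div hn, Nat.div_eq_of_lt j.2, add_zero]
    have h2 : ((k : ℕ) * n + j) % n = j := by
      rw [mul_comm, Nat.mul_add_mod, Nat.mod_eq_of_lt j.2]
    simp [ω, h1, h2]
  -- Durations that are not multiples of `n` are rounded up, at logarithmic cost by (H1).
  have hprefix : ∀ N m : ℕ, N ≤ m → (K (M * n) (List.ofFn fun j : Fin N => ω j) : ℝ) ≤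
      K (M * n) (List.ofFn fun j : Fin m => ω j) + logError c₁ N := by
    intro N m hNm
    obtain ⟨d, rfl⟩ := Nat.exists_eq_add_of_le hNm
    have h1 := hc₁ (List.ofFn fun j : Fin N => ω j) (List.ofFn fun j : Fin d => ω (N + j))
    rw [List.length_ofFn] at h1
    have h2 : (List.ofFn fun j : Fin (N + d) => ω j) =
        (List.ofFn fun j : Fin N => ω j) ++ (List.ofFn fun j : Fin d => ω (N + j)) := by
      rw [List.ofFn_add]
      simp
    rwa [h2]
  have hM : 0 ≤ Real.logb 2 M := logb_two_natCast_nonneg M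
  have hbound : ∀ N : ℕ, (K (M * n) (List.ofFn fun j : Fin N => ω j) : ℝ) ≤
      (N / n + 1) * Real.logb 2 M + logError |c₂| (N + 1) + logError |c₁| (N + 1) := by
    intro N
    have h1 := hprefix N ((N / n + 1) * n) (by
      have := Nat.div_add_mod N n
      have := Nat.mod_lt N hn
      nlinarith)
    rw [hword] at h1
    have h2 := hc₂ (List.ofFn fun k : Fin (N / n + 1) => s k)
    rw [List.length_ofFn] at h2
    have h3 : logError c₂ (N / n + 1) ≤ logError |c₂| (N + 1) :=
      logError_le (by have := Nat.div_le_self N n; omega)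
    have h4 : logError c₁ N ≤ logError |c₁| (N + 1) := logError_le (by omega)
    have h5 : ((N / n + 1 : ℕ) : ℝ) * Real.logb 2 M ≤ (N / n + 1) * Real.logb 2 M := by
      gcongr
      push_cast
      gcongr
      exact Nat.cast_div_le
    linarith
  have hlim : Tendsto (fun N : ℕ => ((N / n + 1) * Real.logb 2 M + logError |c₂| (N + 1)
      + logError |c₁| (N + 1)) / N) atTop (𝓝 (Real.logb 2 M / n)) := by
    have hshift : ∀ c : ℝ, Tendsto (fun N : ℕ => logError c (N + 1) / N) atTop (𝓝 0) := by
      intro c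
      have h1 := (tendsto_add_atTop_iff_nat 1).2 (tendsto_logError_div c)
      have h2 : Tendsto (fun N : ℕ => 1 + ((N : ℝ))⁻¹) atTop (𝓝 (1 + 0)) :=
        tendsto_const_nhds.add (tendsto_inv_atTop_zero.comp tendsto_natCast_atTop_atTop)
      have h3 := h1.mul h2
      rw [zero_mul] at h3
      refine h3.congr' ?_
      filter_upwards [eventually_gt_atTop 0] with N hN
      have : (N : ℝ) ≠ 0 := by positivity
      have : (N : ℝ) + 1 ≠ 0 := by positivity
      push_cast
      field_simp
    have h1 : Tendsto (fun N : ℕ => ((n : ℝ)⁻¹ + (N : ℝ)⁻¹) * Real.logb 2 M +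
        logError |c₂| (N + 1) / N + logError |c₁| (N + 1) / N) atTop
        (𝓝 (((n : ℝ)⁻¹ + 0) * Real.logb 2 M + 0 + 0)) :=
      (((tendsto_const_nhds.add (tendsto_inv_atTop_zero.comp
        tendsto_natCast_atTop_atTop)).mul_const _).add (hshift _)).add (hshift _)
    have h2 : ((n : ℝ)⁻¹ + 0) * Real.logb 2 M + 0 + 0 = Real.logb 2 M / n := by ring
    rw [h2] at h1
    refine h1.congr' ?_
    filter_upwards [eventually_gt_atTop 0] with N hN
    have : (N : ℝ) ≠ 0 := by positivity
    have : (n : ℝ) ≠ 0 := by positivity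
    field_simp
  refine (limsup_le_limsup ?_).trans_eq
    ((ENNReal.continuous_ofReal.tendsto _).comp hlim).limsup_eq
  filter_upwards [eventually_gt_atTop 0] with N hN
  have hN' : (0 : ℝ) < N := by positivity
  simp only [Function.comp]
  rw [ENNReal.ofReal_div_of_pos hN', ENNReal.ofReal_natCast]
  gcongr
  refine (iInf₂_le (fun j : Fin N => ω j) (hcode N)).trans ?_
  rw [← ENNReal.ofReal_coe_nnreal]
  exact ENNReal.ofReal_le_ofReal (hbound N)

/-- The complexity in a window is at most proportional to the length of the window. -/
theorem exists_windowComplexity_le (hA1 : S.WindowsCompact) (hA2 : S.BallsGlue) (hH1 : K.Concat)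
    (hH3 : K.Shannon) (τ : ℝ) {ε : ℝ} (hε : 0 < ε) :
    ∃ B : ℝ≥0, ∀ (x : ℝ) (P : ℕ), 1 ≤ P → ∀ f : S.State,
      S.windowComplexity K τ ε x (x + P) f ≤ B * P := by
  obtain ⟨q, hq0, hq⟩ := hA2.exists_gluesWith
  obtain ⟨M, hM⟩ := exists_hasStringCover_one hA1 τ hε (by norm_num : (0 : ℝ) < 0 + 1)
  refine ⟨(Real.logb 2 (M * q ^ 1 : ℕ)).toNNReal, fun x P hP f => ?_⟩
  have h1 := (hM.tile hq hq0 hε one_pos hP x).windowComplexity_le hH1 hH3 one_pos f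
  rw [mul_one] at h1
  refine h1.trans_eq ?_
  change _ = ENNReal.ofReal _ * _
  rw [← ENNReal.ofReal_natCast, ← ENNReal.ofReal_mul (logb_two_natCast_nonneg _),
    Nat.cast_pow (M * q ^ 1) P, Real.logb_pow]
  simp [mul_comm]

theorem maxOrbits_mono {a b T T' ε : ℝ} (hT : T ≤ T') :
    S.maxOrbits a b T ε ≤ S.maxOrbits a b T' ε := by
  refine iSup₂_le fun A hA => le_iSup₂_of_le A (fun f hf g hg hfg h => ?_) le_rfl
  exact hA hf hg hfg fun t ht => h t ⟨ht.1, ht.2.trans_le hT⟩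

/-- Economical coverings by strings, over long windows and long times, from the lower
topological entropy. -/
theorem exists_hasStringCover_of_lowerTopEntropy_lt {τ ε c : ℝ} (hτ : 0 < τ) (hε : 0 < ε)
    (hc : S.lowerTopEntropy < ENNReal.ofReal c) (L₁ : ℝ) (n₁ : ℕ) :
    ∃ (a L : ℝ) (n M : ℕ), 0 < L ∧ L₁ ≤ L ∧ 0 < n ∧ n₁ ≤ n ∧ S.HasStringCover τ ε a (a + L) n M ∧
      Real.logb 2 M ≤ c * L * ((n + 1) * τ) := by
  have hc0 : 0 < c := by
    by_contra! h
    rw [ENNReal.ofReal_of_nonpos h] at hc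
    exact not_lt_zero hc
  have h1 := (le_iSup₂ (f := fun (ε : ℝ) (_ : 0 < ε) => liminf (fun Λ : ℝ × ℝ =>
      liminf (fun T : ℝ => log₂card (S.maxOrbits Λ.1 Λ.2 T ε) / ENNReal.ofReal T) atTop
        / ENNReal.ofReal (Λ.2 - Λ.1)) windowsToInfinity) (ε / 2) (by linarith)).trans_lt hc
  have hlarge : ∀ᶠ Λ : ℝ × ℝ in windowsToInfinity, max L₁ 1 ≤ Λ.2 - Λ.1 :=
    tendsto_comap.eventually (eventually_ge_atTop (max L₁ 1))
  obtain ⟨⟨a, b⟩, hΛ, hL⟩ := ((frequently_lt_of_liminf_lt (by isBoundedDefault) h1).and_eventually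
    hlarge).exists
  simp only at hΛ hL
  set L := b - a with hLdef
  have hL1 : 1 ≤ L := (le_max_right _ _).trans hL
  have hL0 : 0 < L := by linarith
  rw [ENNReal.div_lt_iff (Or.inl (by simpa using hL0)) (Or.inl ENNReal.ofReal_ne_top),
    ← ENNReal.ofReal_mul hc0.le] at hΛ
  obtain ⟨T, hT, hT1⟩ := ((frequently_lt_of_liminf_lt (by isBoundedDefault) hΛ).and_eventually
    (eventually_ge_atTop ((n₁ + 1) * τ))).exists
  have hT0 : 0 < T := lt_of_lt_of_le (by positivity) hT1
  rw [ENNReal.div_lt_iff (Or.inl (by simpa using hT0)) (Or.inl ENNReal.ofReal_ne_top),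
    ← ENNReal.ofReal_mul (by positivity)] at hT
  have hne : S.maxOrbits a b T (ε / 2) ≠ ⊤ := by
    intro h
    rw [h, log₂card, if_pos rfl] at hT
    exact not_top_lt hT
  rw [log₂card, if_neg hne, ENNReal.ofReal_lt_ofReal_iff (by positivity)] at hT
  -- Rounding `T` down to `n` time steps only lowers the number of orbits; comparing it with the
  -- volume uses `T ≤ (n + 1) * τ`, hence the factor `n + 1` in the conclusion.
  set n := ⌊T / τ⌋₊ with hn
  have hnT : n * τ ≤ T := by
    have := Nat.floor_le (by positivity : 0 ≤ T / τ)
    rwa [le_div_iff₀ hτ] at this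
  have hTn : T ≤ (n + 1) * τ := by
    have := (Nat.lt_floor_add_one (T / τ)).le
    rwa [div_le_iff₀ hτ] at this
  have hn1 : n₁ + 1 ≤ n := by
    refine Nat.le_floor ?_
    rw [le_div_iff₀ hτ]
    push_cast
    exact hT1
  have hmono := S.maxOrbits_mono (a := a) (b := b) (ε := ε / 2) hnT
  have hne' : S.maxOrbits a b (n * τ) (ε / 2) ≠ ⊤ := ne_top_of_le_ne_top hne hmono
  have hcov := hasStringCover_of_maxOrbits hτ hε (by linarith : a < b) n hne'
  have hpos := hcov.pos
  refine ⟨a, L, n, (S.maxOrbits a b (n * τ) (ε / 2)).toNat, hL0, (le_max_left _ _).trans hL, by omega, by omega, ?_, ?_⟩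
  · rwa [hLdef, add_sub_cancel]
  · calc _ ≤ Real.logb 2 (S.maxOrbits a b T (ε / 2)).toNat := by
          refine Real.logb_le_logb_of_le one_lt_two (by exact_mod_cast hpos) ?_
          exact_mod_cast ENat.toNat_le_toNat hmono hne
      _ ≤ c * L * T := hT.le
      _ ≤ _ := by gcongr

/-- Two errors occur: a factor `(n + 1) / n` from the discretization of time, and `log q` per tile
and time step from gluing, that is `log q / L` per unit length. Both vanish when `L` and `n` are
chosen at least `m` and `m → ∞`. The bound is uniform in `f`. -/
theorem pointComplexity_le_of_lowerTopEntropy_lt (hA2 : S.BallsGlue) (hH1 : K.Concat)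
    (hH3 : K.Shannon) {τ ε c : ℝ} (hτ : 0 < τ) (hε : 0 < ε) {a b : ℕ → ℝ}
    (hab : AdmissibleWindows a b) (hc : S.lowerTopEntropy < ENNReal.ofReal c) (f : S.State) :
    S.pointComplexity K τ ε a b f ≤ ENNReal.ofReal (c * τ) := by
  have hc0 : 0 < c := by
    by_contra! h
    rw [ENNReal.ofReal_of_nonpos h] at hc
    exact not_lt_zero hc
  obtain ⟨q, hq0, hq⟩ := hA2.exists_gluesWith
  have hlq : 0 ≤ Real.logb 2 q := logb_two_natCast_nonneg q
  have key : ∀ m : ℕ, 0 < m → S.pointComplexity K τ ε a b f ≤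
      ENNReal.ofReal (c * τ + (c * τ + Real.logb 2 q) / m) := by
    intro m hm
    obtain ⟨x, L, n, M, hL0, hL, hn0, hn, hcov, hM⟩ :=
      exists_hasStringCover_of_lowerTopEntropy_lt hτ hε hc m m
    have hm' : (0 : ℝ) < m := by positivity
    have hn' : (0 : ℝ) < n := by positivity
    set D := c * L * τ * ((n + 1) / n) + Real.logb 2 q with hD
    have hD0 : 0 ≤ D := by positivity
    have hlim : Tendsto (fun k => (1 / L + (b k - a k)⁻¹) * D) atTop (𝓝 ((1 / L + 0) * D)) :=
      (tendsto_const_nhds.add (tendsto_inv_atTop_zero.comp hab.length)).mul_const D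
    refine (limsup_le_limsup (Eventually.of_forall fun k => ?_)).trans
      (((ENNReal.continuous_ofReal.tendsto _).comp hlim).limsup_eq.le.trans
        (ENNReal.ofReal_le_ofReal ?_))
    · have hk := hab.lt k
      have hl : 0 < b k - a k := sub_pos.2 hk
      set P := ⌈(b k - a k) / L⌉₊ with hP
      have hP1 : 1 ≤ P := Nat.ceil_pos.2 (by positivity)
      have hPle : (P : ℝ) ≤ (b k - a k) / L + 1 := (Nat.ceil_lt_add_one (by positivity)).le
      have hPge : b k ≤ a k + P * L := by
        have := Nat.le_ceil ((b k - a k) / L)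
        rw [div_le_iff₀ hL0] at this
        linarith
      have h1 := ((hcov.tile hq hq0 hε hL0 hP1 (a k)).mono_window le_rfl hk
        hPge).windowComplexity_le hH1 hH3 hn0 f
      simp only [Function.comp]
      rw [ENNReal.div_le_iff (by simpa using hl) ENNReal.ofReal_ne_top,
        ← ENNReal.ofReal_mul (by positivity)]
      refine h1.trans (ENNReal.ofReal_le_ofReal ?_)
      have hMne : (M : ℝ) ≠ 0 := by exact_mod_cast hcov.pos.ne'
      have hqne : (q : ℝ) ≠ 0 := by exact_mod_cast hq0.ne'
      push_cast
      rw [Real.logb_pow, Real.logb_mul hMne (pow_ne_zero _ hqne), Real.logb_pow]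
      have h2 : (Real.logb 2 M + n * Real.logb 2 q) / n ≤ D := by
        rw [add_div, mul_div_cancel_left₀ _ hn'.ne', hD]
        gcongr
        rw [div_le_iff₀ hn']
        calc _ ≤ c * L * ((n + 1) * τ) := hM
          _ = _ := by field_simp
      have hlM := logb_two_natCast_nonneg M
      calc _ = P * ((Real.logb 2 M + n * Real.logb 2 q) / n) := by ring
        _ ≤ ((b k - a k) / L + 1) * D := by gcongr
        _ = _ := by field_simp
    · have h1 : (1 / L + 0) * D = c * τ * (1 + 1 / n) + Real.logb 2 q / L := by
        rw [hD, add_zero]; field_simp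
      rw [h1]
      have h2 : (1 : ℝ) / n ≤ 1 / m := by gcongr
      have h3 : Real.logb 2 q / L ≤ Real.logb 2 q / m := by gcongr
      have h4 : c * τ * (1 + 1 / n) ≤ c * τ * (1 + 1 / m) := by gcongr
      calc _ ≤ c * τ * (1 + 1 / m) + Real.logb 2 q / m := by linarith
        _ = _ := by ring
  have hlim : Tendsto (fun m : ℕ => c * τ + (c * τ + Real.logb 2 q) / m) atTop
      (𝓝 (c * τ + 0)) := tendsto_const_nhds.add (tendsto_const_div_atTop_nhds_zero_nat _)
  rw [add_zero] at hlim
  refine ge_of_tendsto ((ENNReal.continuous_ofReal.tendsto _).comp hlim) ?_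
  filter_upwards [eventually_gt_atTop 0] with m hm using key m hm

/-- The complexity of an invariant measure does not exceed the lower topological entropy. -/
theorem measureComplexity_le_lowerTopEntropy (hA2 : S.BallsGlue) (hH1 : K.Concat)
    (hH3 : K.Shannon) {τ : ℝ} (hτ : 0 < τ) {a b : ℕ → ℝ} (hab : AdmissibleWindows a b)
    (μ : Measure S.State) [IsProbabilityMeasure μ] :
    S.measureComplexity K τ a b μ ≤ S.lowerTopEntropy := by
  refine le_of_forall_gt fun x hx => ?_
  obtain ⟨c, hc, hcx⟩ := ENNReal.lt_iff_exists_nnreal_btwn.1 hx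
  refine lt_of_le_of_lt ?_ hcx
  rw [← ENNReal.ofReal_coe_nnreal] at hc ⊢
  rw [measureComplexity, ENNReal.div_le_iff (by simpa using hτ) ENNReal.ofReal_ne_top,
    ← ENNReal.ofReal_mul (NNReal.coe_nonneg c)]
  refine iSup₂_le fun ε hε => ?_
  refine (lintegral_mono fun f =>
    pointComplexity_le_of_lowerTopEntropy_lt hA2 hH1 hH3 hτ hε hab hc f).trans ?_
  simp

end ExtendedSystem

/-! ### Means on bounded functions -/

/-- A real function bounded in absolute value. -/
def BddFun {X : Type*} (f : X → ℝ) : Prop := ∃ C : ℝ, ∀ x, |f x| ≤ C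

theorem BddFun.add {X : Type*} {f g : X → ℝ} (hf : BddFun f) (hg : BddFun g) :
    BddFun (f + g) := by
  obtain ⟨C, hC⟩ := hf
  obtain ⟨D, hD⟩ := hg
  exact ⟨C + D, fun x => (abs_add_le _ _).trans (add_le_add (hC x) (hD x))⟩

theorem BddFun.smul {X : Type*} {f : X → ℝ} (c : ℝ) (hf : BddFun f) : BddFun (c • f) := by
  obtain ⟨C, hC⟩ := hf
  exact ⟨|c| * C, fun x => by
    simpa [abs_mul] using mul_le_mul_of_nonneg_left (hC x) (abs_nonneg c)⟩

theorem BddFun.comp {X Y : Type*} {f : X → ℝ} (hf : BddFun f) (u : Y → X) :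
    BddFun fun y => f (u y) := by
  obtain ⟨C, hC⟩ := hf
  exact ⟨C, fun y => hC (u y)⟩

/-- A mean: a linear functional on bounded functions lying between infimum and supremum. -/
structure IsMean {X : Type*} (m : (X → ℝ) → ℝ) : Prop where
  add : ∀ f g, BddFun f → BddFun g → m (f + g) = m f + m g
  smul : ∀ (c : ℝ) f, BddFun f → m (c • f) = c * m f
  le_of_forall_le : ∀ (c : ℝ) f, BddFun f → (∀ x, c ≤ f x) → c ≤ m f

namespace IsMean

variable {X : Type*} {m : (X → ℝ) → ℝ}

theorem le_of_forall_ge (hm : IsMean m) {c : ℝ} {f : X → ℝ} (hf : BddFun f)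
    (h : ∀ x, f x ≤ c) : m f ≤ c := by
  have h1 := hm.le_of_forall_le (-c) ((-1 : ℝ) • f) (hf.smul _) fun x => by simpa using h x
  rw [hm.smul _ _ hf] at h1
  linarith

theorem abs_le (hm : IsMean m) {C : ℝ} {f : X → ℝ} (h : ∀ x, |f x| ≤ C) : |m f| ≤ C :=
  _root_.abs_le.2 ⟨hm.le_of_forall_le _ _ ⟨C, h⟩ fun x => (_root_.abs_le.1 (h x)).1,
    hm.le_of_forall_ge ⟨C, h⟩ fun x => (_root_.abs_le.1 (h x)).2⟩

end IsMean

/-- The limit of a bounded family of reals along an ultrafilter. -/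
noncomputable def ultraLim {ι : Type*} (u : Ultrafilter ι) (x : ι → ℝ) : ℝ :=
  limUnder (u : Filter ι) x

theorem tendsto_ultraLim {ι : Type*} (u : Ultrafilter ι) {x : ι → ℝ} (hx : BddFun x) :
    Tendsto x u (𝓝 (ultraLim u x)) := by
  obtain ⟨C, hC⟩ := hx
  obtain ⟨l, -, hl⟩ := (isCompact_Icc (a := -C) (b := C)).ultrafilter_le_nhds (u.map x)
    (by
      rw [le_principal_iff]
      exact mem_map.2 (univ_mem' fun i => abs_le.1 (hC i)))
  exact tendsto_nhds_limUnder ⟨l, hl⟩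

theorem IsMean.bddFun {ι X : Type*} {J : ι → (X → ℝ) → ℝ} (hJ : ∀ i, IsMean (J i)) {f : X → ℝ}
    (hf : BddFun f) : BddFun fun i => J i f := by
  obtain ⟨C, hC⟩ := hf
  exact ⟨C, fun i => (hJ i).abs_le hC⟩

/-- Bounded families converge along an ultrafilter, and limits preserve linear relations and
inequalities. -/
theorem IsMean.ultraLim {ι X : Type*} (u : Ultrafilter ι) {J : ι → (X → ℝ) → ℝ}
    (hJ : ∀ i, IsMean (J i)) : IsMean fun f => ultraLim u fun i => J i f where
  add f g hf hg := by
    have h1 := (tendsto_ultraLim u (bddFun hJ hf)).add (tendsto_ultraLim u (bddFun hJ hg))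
    refine tendsto_nhds_unique (tendsto_ultraLim u (bddFun hJ (hf.add hg))) (h1.congr fun i => ?_)
    exact ((hJ i).add f g hf hg).symm
  smul c f hf := by
    have h1 := (tendsto_ultraLim u (bddFun hJ hf)).const_mul c
    refine tendsto_nhds_unique (tendsto_ultraLim u (bddFun hJ (hf.smul c))) (h1.congr fun i => ?_)
    exact ((hJ i).smul c f hf).symm
  le_of_forall_le c f hf h :=
    ge_of_tendsto' (tendsto_ultraLim u (bddFun hJ hf)) fun i => (hJ i).le_of_forall_le c f hf h

theorem IsMean.bddFun_orbit {A X : Type*} {J : (X → ℝ) → ℝ} (hJ : IsMean J) (act : A → X → X)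
    {F : X → ℝ} (hF : BddFun F) : BddFun fun a => J fun x => F (act a x) := by
  obtain ⟨C, hC⟩ := hF
  exact ⟨C, fun a => hJ.abs_le fun x => hC _⟩

/-- A mean on the group composed with the action on functions of a mean on the space. -/
theorem IsMean.orbit {A X : Type*} {m : (A → ℝ) → ℝ} (hm : IsMean m) {J : (X → ℝ) → ℝ}
    (hJ : IsMean J) (act : A → X → X) : IsMean fun F => m fun a => J fun x => F (act a x) where
  add f g hf hg := by
    rw [← hm.add _ _ (hJ.bddFun_orbit act hf) (hJ.bddFun_orbit act hg)]
    congr 1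
    funext a
    exact hJ.add _ _ (hf.comp _) (hg.comp _)
  smul c f hf := by
    rw [← hm.smul _ _ (hJ.bddFun_orbit act hf)]
    congr 1
    funext a
    exact hJ.smul _ _ (hf.comp _)
  le_of_forall_le c f hf h :=
    hm.le_of_forall_le _ _ (hJ.bddFun_orbit act hf)
      fun a => hJ.le_of_forall_le _ _ (hf.comp _) fun x => h _

/-! ### Invariant means on commutative groups -/

section InvariantMean

variable {A : Type*} [AddCommGroup A]

/-- The average of `f` along the segment `x, x + a, …, x + M a`. -/
noncomputable def segmentAverage (M : ℕ) (a : A) (f : A → ℝ) : A → ℝ :=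
  fun x => (∑ i ∈ Finset.range (M + 1), f (x + i • a)) / (M + 1)

theorem segmentAverage_add (M : ℕ) (a : A) (f g : A → ℝ) :
    segmentAverage M a (f + g) = segmentAverage M a f + segmentAverage M a g := by
  funext x
  simp [segmentAverage, Finset.sum_add_distrib, add_div]

theorem segmentAverage_smul (M : ℕ) (a : A) (c : ℝ) (f : A → ℝ) :
    segmentAverage M a (c • f) = c • segmentAverage M a f := by
  funext x
  simp only [segmentAverage, Pi.smul_apply, smul_eq_mul, ← Finset.mul_sum, mul_div_assoc]

theorem le_segmentAverage (M : ℕ) (a : A) {c : ℝ} {f : A → ℝ} (h : ∀ x, c ≤ f x) (x : A) :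
    c ≤ segmentAverage M a f x := by
  rw [segmentAverage, le_div_iff₀ (by positivity)]
  have := Finset.card_nsmul_le_sum (Finset.range (M + 1)) (fun i => f (x + i • a)) c
    fun i _ => h _
  simp only [Finset.card_range, nsmul_eq_mul] at this
  push_cast at this
  linarith

theorem segmentAverage_comm (M : ℕ) (a b : A) (f : A → ℝ) :
    segmentAverage M a (segmentAverage M b f) = segmentAverage M b (segmentAverage M a f) := by
  funext x
  simp only [segmentAverage, ← Finset.sum_div]
  rw [Finset.sum_comm]
  simp only [add_right_comm]

/-- The sum telescopes to two boundary values. -/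
theorem abs_segmentAverage_sub_le (M : ℕ) (a : A) {C : ℝ} {f : A → ℝ} (h : ∀ x, |f x| ≤ C)
    (x : A) : |segmentAverage M a (fun y => f (y + a) - f y) x| ≤ 2 * C / (M + 1) := by
  have h1 : ∑ i ∈ Finset.range (M + 1), (f (x + i • a + a) - f (x + i • a)) =
      f (x + (M + 1) • a) - f x := by
    have := Finset.sum_range_sub (fun i => f (x + i • a)) (M + 1)
    simpa [succ_nsmul, add_assoc] using this
  rw [segmentAverage, h1, abs_div, abs_of_pos (by positivity : (0 : ℝ) < M + 1)]
  gcongr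
  calc _ ≤ |f (x + (M + 1) • a)| + |f x| := abs_sub _ _
    _ ≤ 2 * C := by linarith [h (x + (M + 1) • a), h x]

/-- Average over the box spanned by a list of vectors. -/
noncomputable def boxAverage (M : ℕ) (l : List A) (f : A → ℝ) : A → ℝ :=
  l.foldr (segmentAverage M) f

theorem isMean_boxAverage (M : ℕ) (l : List A) (x : A) :
    IsMean fun f => boxAverage M l f x where
  add f g _ _ := by
    have : boxAverage M l (f + g) = boxAverage M l f + boxAverage M l g := by
      induction l with
      | nil => rfl
      | cons a l ih => simp only [boxAverage, List.foldr_cons] at ih ⊢; rw [ih, segmentAverage_add]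
    rw [this]; rfl
  smul c f _ := by
    have : boxAverage M l (c • f) = c • boxAverage M l f := by
      induction l with
      | nil => rfl
      | cons a l ih => simp only [boxAverage, List.foldr_cons] at ih ⊢; rw [ih, segmentAverage_smul]
    rw [this]; rfl
  le_of_forall_le c f _ h := by
    induction l generalizing x with
    | nil => exact h x
    | cons a l ih => exact le_segmentAverage M a (fun x => ih x) x

theorem boxAverage_perm (M : ℕ) {l l' : List A} (h : l.Perm l') (f : A → ℝ) :
    boxAverage M l f = boxAverage M l' f := by
  have : LeftCommutative (segmentAverage M : A → (A → ℝ) → A → ℝ) :=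
    ⟨fun a b f => segmentAverage_comm M a b f⟩
  exact h.foldr_eq f

theorem boxAverage_append_singleton (M : ℕ) (l : List A) (a : A) (f : A → ℝ) :
    boxAverage M (l ++ [a]) f = boxAverage M l (segmentAverage M a f) := by
  simp [boxAverage]

/-- Segment averages commute, so the one in direction `a` can be performed first, where it
telescopes; the others do not increase the bound. -/
theorem abs_boxAverage_sub_le (M : ℕ) {l : List A} {a : A} (ha : a ∈ l) {C : ℝ} {f : A → ℝ}
    (h : ∀ x, |f x| ≤ C) (x : A) :
    |boxAverage M l (fun y => f (y + a) - f y) x| ≤ 2 * C / (M + 1) := by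
  classical
  have hp : l.Perm (l.erase a ++ [a]) :=
    (List.perm_cons_erase ha).trans (List.perm_append_singleton a _).symm
  rw [boxAverage_perm M hp, boxAverage_append_singleton]
  exact (isMean_boxAverage M (l.erase a) x).abs_le fun y => abs_segmentAverage_sub_le M a h y

variable (A) in
/-- Commutative groups carry an invariant mean. -/
theorem exists_invariant_mean : ∃ m : (A → ℝ) → ℝ, IsMean m ∧
    ∀ f, BddFun f → ∀ a, m (fun x => f (x + a)) = m f := by
  classical
  -- Along `atTop` the box eventually has any given vector `a` among its sides, and the lengths of
  -- its sides tend to infinity.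
  let u : Ultrafilter (Finset A × ℕ) := Ultrafilter.of atTop
  have hu : (u : Filter (Finset A × ℕ)) ≤ atTop := Ultrafilter.of_le _
  have hJ : ∀ i : Finset A × ℕ, IsMean fun f : A → ℝ => boxAverage i.2 i.1.toList f 0 :=
    fun i => isMean_boxAverage _ _ _
  have hm := IsMean.ultraLim u hJ
  refine ⟨_, hm, fun f hf a => ?_⟩
  have hfa : BddFun fun x => f (x + a) := hf.comp _
  have hsub : (fun x => f (x + a) - f x) = (fun x => f (x + a)) + (-1 : ℝ) • f := by
    funext x; simp [sub_eq_add_neg]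
  have h1 := hm.add _ _ hfa (hf.smul (-1))
  rw [hm.smul _ _ hf, ← hsub] at h1
  suffices h : ultraLim u (fun i => boxAverage i.2 i.1.toList (fun x => f (x + a) - f x) 0) = 0 by
    rw [h] at h1
    linarith
  have hb : BddFun fun x => f (x + a) - f x := by rw [hsub]; exact hfa.add (hf.smul _)
  refine tendsto_nhds_unique (tendsto_ultraLim u (IsMean.bddFun hJ hb)) (Tendsto.mono_left ?_ hu)
  obtain ⟨C, hC⟩ := hf
  have hlim : Tendsto (fun i : Finset A × ℕ => 2 * C / ((i.2 : ℝ) + 1)) atTop (𝓝 0) := by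
    have h2 : Tendsto (fun i : Finset A × ℕ => i.2) atTop atTop := by
      rw [← prod_atTop_atTop_eq]; exact tendsto_snd
    exact tendsto_const_nhds.div_atTop
      (tendsto_atTop_add_const_right _ _ (tendsto_natCast_atTop_atTop.comp h2))
  refine squeeze_zero_norm' ?_ hlim
  filter_upwards [eventually_ge_atTop (({a} : Finset A), 0)] with i hi
  exact abs_boxAverage_sub_le i.2 (Finset.mem_toList.2 (hi.1 (Finset.mem_singleton_self a))) hC 0

end InvariantMean

/-! ### Invariant measures from sequences of means -/

theorem Continuous.bddFun {X : Type*} [TopologicalSpace X] [CompactSpace X] {F : X → ℝ}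
    (hF : Continuous F) : BddFun F := by
  obtain ⟨C, hC⟩ := isCompact_univ.exists_bound_of_continuousOn hF.continuousOn
  exact ⟨C, fun x => hC x (mem_univ x)⟩

/-- This is the Riesz–Markov theorem; on a compact space every continuous function is bounded and
has compact support, and the mean of `1` gives the total mass. -/
theorem exists_measure_of_isMean {X : Type*} [TopologicalSpace X] [T2Space X] [CompactSpace X]
    [MeasurableSpace X] [BorelSpace X] {m : (X → ℝ) → ℝ} (hm : IsMean m) :
    ∃ μ : Measure X, IsProbabilityMeasure μ ∧
      ∀ F : X → ℝ, Continuous F → ∫ x, F x ∂μ = m F := by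
  let l : CompactlySupportedContinuousMap X ℝ →ₗ[ℝ] ℝ :=
    { toFun := fun F => m F
      map_add' := fun F G => hm.add F G F.continuous.bddFun G.continuous.bddFun
      map_smul' := fun c F => hm.smul c F F.continuous.bddFun }
  let Λ : CompactlySupportedContinuousMap X ℝ →ₚ[ℝ] ℝ := PositiveLinearMap.mk₀ l
    fun F hF => hm.le_of_forall_le 0 _ F.continuous.bddFun hF
  have hint : ∀ F : X → ℝ, Continuous F → ∫ x, F x ∂(RealRMK.rieszMeasure Λ) = m F := by
    intro F hF
    exact RealRMK.integral_rieszMeasure Λ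
      ⟨⟨F, hF⟩, HasCompactSupport.of_compactSpace F⟩
  refine ⟨RealRMK.rieszMeasure Λ, ⟨?_⟩, hint⟩
  have h1 := hint (fun _ => 1) continuous_const
  have h2 : m (fun _ => 1) = 1 :=
    le_antisymm (hm.le_of_forall_ge continuous_const.bddFun fun _ => le_rfl)
      (hm.le_of_forall_le _ _ continuous_const.bddFun fun _ => le_rfl)
  rw [h2, integral_const, smul_eq_mul, mul_one, measureReal_def] at h1
  rwa [ENNReal.toReal_eq_one_iff] at h1

/-- Given a sequence of means on a compact space with a continuous action of a commutative group,
there is an invariant probability measure for which the integral of any continuous function is at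
least the asymptotic lower bound of the means of all its translates. -/
theorem exists_invariant_measure {A X : Type*} [AddCommGroup A] [TopologicalSpace X] [T2Space X]
    [CompactSpace X] [TopologicalSpace.PseudoMetrizableSpace X] [MeasurableSpace X] [BorelSpace X]
    (act : A → X → X) (hact : ∀ a, Continuous (act a))
    (hadd : ∀ a b x, act (a + b) x = act a (act b x))
    {J : ℕ → (X → ℝ) → ℝ} (hJ : ∀ j, IsMean (J j)) :
    ∃ μ : Measure X, IsProbabilityMeasure μ ∧ (∀ a, MeasurePreserving (act a) μ μ) ∧
      ∀ (F : X → ℝ) (c : ℝ), Continuous F →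
        (∀ a, ∀ η > 0, ∀ᶠ j in atTop, c - η ≤ J j fun x => F (act a x)) → c ≤ ∫ x, F x ∂μ := by
  let u : Ultrafilter ℕ := Ultrafilter.of atTop
  have hu : (u : Filter ℕ) ≤ atTop := Ultrafilter.of_le _
  have hJ₁ := IsMean.ultraLim u hJ
  obtain ⟨m, hm, hinv⟩ := exists_invariant_mean A
  -- The ultralimit need not be invariant under the whole group. Averaging its translates with an
  -- invariant mean on `A` makes it so, and needs no measurability or continuity of the action in
  -- the group variable.
  have hΦ := hm.orbit hJ₁ act
  obtain ⟨μ, hμ, hint⟩ := exists_measure_of_isMean hΦ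
  have hbdd' : ∀ F : X → ℝ, Continuous F →
      BddFun fun a => ultraLim u fun j => J j fun x => F (act a x) :=
    fun F hF => hJ₁.bddFun_orbit act hF.bddFun
  refine ⟨μ, hμ, fun a => ⟨(hact a).measurable, ?_⟩, fun F c hF h => ?_⟩
  · have := Measure.isProbabilityMeasure_map (μ := μ) (hact a).aemeasurable
    refine ext_of_forall_integral_eq_of_IsFiniteMeasure fun F => ?_
    rw [integral_map (hact a).aemeasurable F.continuous.aestronglyMeasurable,
      hint (fun x => F (act a x)) (F.continuous.comp (hact a)), hint _ F.continuous,
      ← hinv _ (hbdd' _ F.continuous) a]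
    simp only [add_comm _ a, hadd]
  · rw [hint F hF]
    refine hm.le_of_forall_le _ _ (hbdd' F hF) fun a => le_of_forall_pos_sub_le fun η hη => ?_
    exact ge_of_tendsto (tendsto_ultraLim u (IsMean.bddFun hJ (hF.bddFun.comp (act a))))
      (hu (h a η hη))

/-! ### Counting -/

/-- Jensen's inequality for a code with Kraft sum at most `B`: the mean cost is at least the
logarithm of the number of coded objects, up to `log B`. -/
theorem card_mul_log_le_sum_cost {X : Type*} (E : Finset X) (h : X → ℝ) {B : ℝ} (hB : 0 < B)
    (hsum : ∑ f ∈ E, (2 : ℝ) ^ (-h f) ≤ B) :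
    E.card * (Real.logb 2 E.card - Real.logb 2 B) ≤ ∑ f ∈ E, h f := by
  rcases E.eq_empty_or_nonempty with rfl | hE
  · simp
  have hcard : (0 : ℝ) < E.card := by exact_mod_cast hE.card_pos
  set s := Real.logb 2 E.card - Real.logb 2 B with hs
  have h2s : (2 : ℝ) ^ s = E.card / B := by
    rw [hs, ← Real.logb_div hcard.ne' hB.ne',
      Real.rpow_logb two_pos (by norm_num) (div_pos hcard hB)]
  have hlog : 0 < Real.log 2 := Real.log_pos one_lt_two
  -- The tangent inequality `1 + x ≤ exp x` replaces convexity; `s` is chosen so that the right-hand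
  -- sides add up to at most `E.card`.
  have h1 : ∀ f, 1 + Real.log 2 * (s - h f) ≤ (2 : ℝ) ^ s * (2 : ℝ) ^ (-h f) := by
    intro f
    rw [← Real.rpow_add two_pos, Real.rpow_def_of_pos two_pos, ← sub_eq_add_neg]
    linarith [Real.add_one_le_exp (Real.log 2 * (s - h f))]
  have h2 : ∑ f ∈ E, (1 + Real.log 2 * (s - h f)) ≤ E.card := by
    calc _ ≤ ∑ f ∈ E, (2 : ℝ) ^ s * (2 : ℝ) ^ (-h f) := Finset.sum_le_sum fun f _ => h1 f
      _ ≤ E.card / B * B := by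
        rw [← Finset.mul_sum, h2s]
        gcongr
      _ = E.card := by field_simp
  rw [Finset.sum_add_distrib, ← Finset.mul_sum, Finset.sum_sub_distrib] at h2
  simp only [Finset.sum_const, nsmul_eq_mul, mul_one] at h2
  have h3 : Real.log 2 * (E.card * s - ∑ f ∈ E, h f) ≤ 0 := by linarith
  have h4 := nonpos_of_mul_nonpos_right h3 hlog
  linarith

theorem isMean_finset_average {ι X : Type*} {s : Finset ι} (hs : s.Nonempty) (p : ι → X) :
    IsMean fun F : X → ℝ => (∑ i ∈ s, F (p i)) / s.card where
  add f g _ _ := by simp [Finset.sum_add_distrib, add_div]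
  smul c f _ := by simp [← Finset.mul_sum, mul_div_assoc]
  le_of_forall_le c f _ h := by
    rw [le_div_iff₀ (by exact_mod_cast hs.card_pos)]
    have := Finset.card_nsmul_le_sum s (fun i => f (p i)) c fun i _ => h _
    simpa [mul_comm] using this

/-! ### Coding orbits by space-time arrays of tiles -/

namespace ExtendedSystem

variable {S : ExtendedSystem}

/-- A finite family of strings of `n` balls over `[α, α + L]`, of radius `< ε`, with costs. -/
structure TileCode (S : ExtendedSystem) (τ ε α : ℝ) (L n : ℕ) (Ω : Type*) where
  cost : Ω → ℝ
  center : Ω → ℕ → S.State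
  radius : Ω → ℕ → ℝ
  radius_mem : ∀ ω j, 0 < radius ω j ∧ radius ω j < ε

namespace TileCode

variable {τ ε α : ℝ} {L n : ℕ} {Ω : Type*}

/-- The orbit of `f` follows the string `ω`. -/
def Follows (W : S.TileCode τ ε α L n Ω) (ω : Ω) (f : S.State) : Prop :=
  ∀ j < n, S.wdist α (α + L) (S.φ (j * τ) f) (W.center ω j) < W.radius ω j

/-- Every orbit can be coded at cost at most `G`. -/
def CodesWithin (W : S.TileCode τ ε α L n Ω) (G : S.State → ℝ) : Prop :=
  ∀ f, ∃ ω, W.Follows ω f ∧ W.cost ω ≤ G f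

/-- The Kraft sum of the costs. -/
noncomputable def kraft [Fintype Ω] (W : S.TileCode τ ε α L n Ω) : ℝ :=
  ∑ ω, (2 : ℝ) ^ (-W.cost ω)

theorem kraft_pos [Fintype Ω] [Nonempty Ω] (W : S.TileCode τ ε α L n Ω) : 0 < W.kraft :=
  Finset.sum_pos (fun _ _ => Real.rpow_pos_of_pos two_pos _) Finset.univ_nonempty

/-- Coding of a finite set of orbits by a `P × Q` array of tiles. -/
theorem CodesWithin.card_mul_le_sum [Fintype Ω] {W : S.TileCode τ ε α L n Ω} {G : S.State → ℝ}
    (hW : W.CodesWithin G) {q : ℕ} (hq : S.GluesWith q) (hq0 : 0 < q) (hε : 0 < ε) (hL : 0 < L)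
    {P Q : ℕ} (hP : 1 ≤ P) (x₀ t₀ : ℝ) (E : Finset S.State)
    (hE : ∀ f ∈ E, ∀ g ∈ E, (∀ k < Q * n, S.wdist x₀ (x₀ + P * L) (S.φ (t₀ + k * τ) f)
      (S.φ (t₀ + k * τ) g) < 2 * ε) → f = g) :
    E.card * (Real.logb 2 E.card - P * Q * (Real.logb 2 W.kraft + n * Real.logb 2 q)) ≤
      ∑ f ∈ E, ∑ p ∈ Finset.range P, ∑ i ∈ Finset.range Q,
        G (S.ζ (x₀ + p * L - α) (S.φ (t₀ + i * n * τ) f)) := by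
  classical
  have hL' : (0 : ℝ) < L := by exact_mod_cast hL
  have hPL : x₀ < x₀ + P * L := by
    have : (0 : ℝ) < P := by exact_mod_cast hP
    have := mul_pos this hL'
    linarith
  have hΩ : Nonempty Ω := by
    obtain ⟨f⟩ : Nonempty S.State := S.nonempty.to_subtype
    exact ⟨(hW f).choose⟩
  choose ω hω hcost using hW
  let c : S.State → ℕ → ℕ → Ω := fun f p i =>
    ω (S.ζ (x₀ + p * L - α) (S.φ (t₀ + i * n * τ) f))
  let c' : S.State → Fin P × Fin Q → Ω := fun f x => c f x.1 x.2
  let ext : (Fin P × Fin Q → Ω) → ℕ → ℕ → Ω := fun w p i =>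
    if h : p < P ∧ i < Q then w (⟨p, h.1⟩, ⟨i, h.2⟩) else Classical.choice hΩ
  have hext : ∀ f p i, p < P → i < Q → ext (c' f) p i = c f p i := by
    intro f p i hp hi
    simp [ext, c', hp, hi]
  choose z σ hσ hz using fun (w : Fin P × Fin Q → Ω) (i j : ℕ) =>
    hq.consecutive hq0 hε hL' x₀ (fun p => S.ζ (-(x₀ + p * L - α)) (W.center (ext w p i) j))
      (fun p => W.radius (ext w p i) j) (fun p => W.radius_mem _ _) hP
  have hfollow : ∀ (f : S.State) (x : Fin Q × Fin n), ∃ k,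
      S.wdist x₀ (x₀ + P * L) (S.φ (x.2 * τ + (t₀ + x.1 * n * τ)) f) (z (c' f) x.1 x.2 k) <
        σ (c' f) x.1 x.2 k := by
    intro f x
    refine hz (c' f) x.1 x.2 _ fun p hp => ?_
    have h1 := hω (S.ζ (x₀ + p * L - α) (S.φ (t₀ + x.1 * n * τ) f)) x.2 x.2.2
    rw [wdist_φ_ζ (by linarith : α < α + L)] at h1
    rw [hext f p x.1 hp x.1.2]
    convert h1 using 2 <;> ring
  choose k hk using hfollow
  -- States with the same tile strings and the same gluing choices lie in common balls of radius `<
  -- ε` at all lattice times, hence within `2 * ε`, and the separation of `E` identifies them.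
  have hinj : Set.InjOn (fun f => (c' f, k f)) E := by
    intro f hf g hg hfg
    simp only [Prod.mk.injEq] at hfg
    refine hE f hf g hg fun m hm => ?_
    have hn : 0 < n := Nat.pos_of_ne_zero (by rintro rfl; simp at hm)
    let x : Fin Q × Fin n := (⟨m / n, Nat.div_lt_of_lt_mul (by rwa [mul_comm])⟩,
      ⟨m % n, Nat.mod_lt _ hn⟩)
    have htime : ((x.2 : ℕ) : ℝ) * τ + (t₀ + ((x.1 : ℕ) : ℝ) * n * τ) = t₀ + m * τ := by
      have h3 : ((n * (m / n) + m % n : ℕ) : ℝ) = m := by rw [Nat.div_add_mod]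
      push_cast at h3
      simp only [x]
      rw [← h3]
      ring
    have h1 := hk f x
    have h2 := hk g x
    rw [htime] at h1 h2
    rw [← hfg.1, ← hfg.2] at h2
    have h3 := wdist_triangle hPL (S.φ (t₀ + m * τ) f) (z (c' f) x.1 x.2 (k f x))
      (S.φ (t₀ + m * τ) g)
    rw [wdist_comm hPL (z (c' f) x.1 x.2 (k f x))] at h3
    have h4 := (hσ (c' f) x.1 x.2 (k f x)).2
    linarith
  -- By injectivity the sum is bounded by that over all pairs: the tile costs factor into powers of
  -- the Kraft sum, and the free gluing choices number `(q ^ P) ^ (Q * n)`.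
  have hkraft : ∑ f ∈ E, (2 : ℝ) ^ (-∑ x : Fin P × Fin Q, W.cost (c' f x)) ≤
      W.kraft ^ (P * Q) * (q : ℝ) ^ (P * Q * n) := by
    have h1 : ∀ w : Fin P × Fin Q → Ω, (2 : ℝ) ^ (-∑ x, W.cost (w x)) =
        ∏ x, (2 : ℝ) ^ (-W.cost (w x)) := by
      intro w
      rw [← Finset.sum_neg_distrib, Real.rpow_sum_of_pos two_pos]
    calc ∑ f ∈ E, (2 : ℝ) ^ (-∑ x : Fin P × Fin Q, W.cost (c' f x))
        = ∑ y ∈ E.image fun f => (c' f, k f), (2 : ℝ) ^ (-∑ x, W.cost (y.1 x)) := by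
          rw [Finset.sum_image hinj]
      _ ≤ ∑ y : (Fin P × Fin Q → Ω) × (Fin Q × Fin n → Fin (q ^ P)),
            (2 : ℝ) ^ (-∑ x, W.cost (y.1 x)) :=
          Finset.sum_le_univ_sum_of_nonneg fun y => (Real.rpow_pos_of_pos two_pos _).le
      _ = W.kraft ^ (P * Q) * (q : ℝ) ^ (P * Q * n) := by
          rw [Fintype.sum_prod_type]
          simp only [Finset.sum_const, Finset.card_univ, Fintype.card_fun, Fintype.card_prod,
            Fintype.card_fin, nsmul_eq_mul, h1]
          rw [← Finset.mul_sum, ← Fintype.prod_sum (fun (_ : Fin P × Fin Q) (ω : Ω) =>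
            (2 : ℝ) ^ (-W.cost ω))]
          simp only [Finset.prod_const, Finset.card_univ, Fintype.card_prod, Fintype.card_fin]
          rw [mul_comm, kraft]
          push_cast
          rw [← pow_mul, mul_assoc]
  have hq' : (0 : ℝ) < q := by exact_mod_cast hq0
  have hZ := W.kraft_pos
  have h1 := card_mul_log_le_sum_cost E (fun f => ∑ x : Fin P × Fin Q, W.cost (c' f x))
    (by positivity) hkraft
  rw [Real.logb_mul (by positivity) (by positivity), Real.logb_pow, Real.logb_pow] at h1
  calc _ = E.card * (Real.logb 2 E.card - (((P * Q : ℕ) : ℝ) * Real.logb 2 W.kraft +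
        ((P * Q * n : ℕ) : ℝ) * Real.logb 2 q)) := by push_cast; ring
    _ ≤ _ := h1
    _ ≤ _ := by
      refine Finset.sum_le_sum fun f _ => ?_
      rw [Fintype.sum_prod_type, Finset.sum_range]
      refine Finset.sum_le_sum fun p _ => ?_
      rw [Finset.sum_range]
      exact Finset.sum_le_sum fun i _ => hcost _

end TileCode

end ExtendedSystem

/-- Summation over residues and quotients. -/
theorem sum_range_mul_eq (F : ℕ → ℝ) (L P : ℕ) :
    ∑ m ∈ Finset.range (L * P), F m =
      ∑ o ∈ Finset.range L, ∑ p ∈ Finset.range P, F (o + p * L) := by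
  rw [Finset.sum_comm]
  induction P with
  | zero => simp
  | succ P ih =>
    rw [Nat.mul_succ, Finset.sum_range_add, ih, Finset.sum_range_succ]
    congr 1
    exact Finset.sum_congr rfl fun o _ => by rw [add_comm, mul_comm]

/-! ### Averaging over the position of the array, and lattice means -/

namespace ExtendedSystem

variable {S : ExtendedSystem}

/-- Coding of a finite set of orbits by arrays of tiles, averaged over the position of the
array. -/
theorem TileCode.CodesWithin.card_mul_le_sum_box {τ ε α : ℝ} {L n : ℕ} {Ω : Type*} [Fintype Ω]
    {W : S.TileCode τ ε α L n Ω} {G : S.State → ℝ} (hW : W.CodesWithin G) {q : ℕ}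
    (hq : S.GluesWith q) (hq0 : 0 < q) (hε : 0 < ε) (hL : 0 < L) {P Q : ℕ} (hP : 2 ≤ P)
    (X T : ℝ) (E : Finset S.State)
    (hE : ∀ f ∈ E, ∀ g ∈ E, (∀ k, n ≤ k → k < Q * n → S.wdist (X + L) (X + P * L)
      (S.φ (T + k * τ) f) (S.φ (T + k * τ) g) < 2 * ε) → f = g) :
    L * n * (E.card * (Real.logb 2 E.card - P * Q * (Real.logb 2 W.kraft + n * Real.logb 2 q))) ≤
      ∑ f ∈ E, ∑ m ∈ Finset.range (L * P), ∑ k ∈ Finset.range (n * Q),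
        G (S.ζ (X + m - α) (S.φ (T + k * τ) f)) := by
  have hL' : (0 : ℝ) < L := by exact_mod_cast hL
  have hP' : (2 : ℝ) ≤ P := by exact_mod_cast hP
  -- Each array shifted by `o < L` in space and `o' < n` in time still covers the window `[X + L, X
  -- + P * L]` and the time indices from `n` to `Q * n - 1`, where `E` is separated. The shifted
  -- arrays together visit every lattice point of the box once.
  have key : ∀ o ∈ Finset.range L, ∀ o' ∈ Finset.range n,
      E.card * (Real.logb 2 E.card - P * Q * (Real.logb 2 W.kraft + n * Real.logb 2 q)) ≤
      ∑ f ∈ E, ∑ p ∈ Finset.range P, ∑ i ∈ Finset.range Q,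
        G (S.ζ (X + (o + p * L : ℕ) - α) (S.φ (T + (o' + i * n : ℕ) * τ) f)) := by
    intro o ho o' ho'
    rw [Finset.mem_range] at ho ho'
    have ho1 : (o : ℝ) ≤ L := by exact_mod_cast ho.le
    refine (hW.card_mul_le_sum hq hq0 hε hL (by omega : 1 ≤ P) (Q := Q) (X + o) (T + o' * τ) E
      fun f hf g hg h => hE f hf g hg fun k hk1 hk2 => ?_).trans_eq ?_
    · have h1 := h (k - o') (by omega)
      have h2 : T + o' * τ + ((k - o' : ℕ) : ℝ) * τ = T + k * τ := by
        rw [Nat.cast_sub (by omega)]; ring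
      rw [h2] at h1
      refine (wdist_mono (by linarith) (by nlinarith) ?_ _ _).trans_lt h1
      have : (0 : ℝ) ≤ o := by positivity
      linarith
    · refine Finset.sum_congr rfl fun f _ => Finset.sum_congr rfl fun p _ =>
        Finset.sum_congr rfl fun i _ => ?_
      congr 2
      · push_cast; ring
      · congr 1; push_cast; ring
  have hsum := Finset.sum_le_sum fun o ho => Finset.sum_le_sum (key o ho)
  simp only [Finset.sum_const, Finset.card_range, nsmul_eq_mul] at hsum
  rw [mul_assoc]
  refine hsum.trans_eq ?_
  simp only [sum_range_mul_eq]
  symm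
  rw [Finset.sum_comm]
  refine Finset.sum_congr rfl fun o _ => ?_
  refine (Finset.sum_congr rfl fun f _ => Finset.sum_comm).trans ?_
  exact Finset.sum_comm

/-- A uniform modulus: states that are `2 ε` close on a window are `ε₀` close up to time `τ`, on
the window deprived of `δ` at both ends. -/
theorem SeparationBound.exists_close (hA3 : S.SeparationBound) (τ : ℝ) {ε₀ : ℝ} (hε₀ : 0 < ε₀) :
    ∃ ε δ : ℝ, 0 < ε ∧ 0 ≤ δ ∧ ∀ A B : ℝ, A < B → ∀ t, 0 ≤ t → t ≤ τ → ∀ f g : S.State,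
      S.wdist (A - δ) (B + δ) f g < 2 * ε → S.wdist A B (S.φ t f) (S.φ t g) < ε₀ := by
  obtain ⟨γ, Γ, C, hγ, hΓ, hC, H⟩ := hA3
  set D := Γ * Real.exp (γ * |τ|) with hD
  have hexp : 1 ≤ Real.exp (γ * |τ|) := Real.one_le_exp (by positivity)
  have hD1 : 1 ≤ D := by nlinarith
  set η := ε₀ / D with hη
  have hη0 : 0 < η := by positivity
  have hηle : η ≤ ε₀ := div_le_self hε₀.le hD1
  refine ⟨η / 2, C * η⁻¹ * (|τ| + 1), by positivity, by positivity,
    fun A B hAB t ht0 htτ f g hfg => ?_⟩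
  rw [mul_div_cancel₀ _ (two_ne_zero' ℝ)] at hfg
  have htτ' : t ≤ |τ| := htτ.trans (le_abs_self τ)
  set δ := C * η⁻¹ * (t + 1) with hδ
  have hCη : 0 < C * η⁻¹ := by positivity
  have hδ0 : 0 < δ := by positivity
  have hδle : δ ≤ C * η⁻¹ * (|τ| + 1) := by rw [hδ]; gcongr
  have hfg' : S.wdist (A - δ) (B + δ) f g < η :=
    (wdist_mono (by linarith) (by linarith) (by linarith) f g).trans_lt hfg
  -- (A3) excludes `t = 0`, where monotonicity in the window suffices.
  rcases ht0.eq_or_lt with rfl | ht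
  · rw [φ_zero, φ_zero]
    exact ((wdist_mono (by linarith) hAB (by linarith) f g).trans_lt hfg').trans_le hηle
  have h1 : 2 * C * η⁻¹ < B + δ - (A - δ) := by
    have : C * η⁻¹ ≤ δ := by rw [hδ]; nlinarith
    linarith
  have h2 : t < C⁻¹ * (B + δ - (A - δ)) * η := by
    have h3 : C⁻¹ * (2 * δ) * η = 2 * (t + 1) := by rw [hδ]; field_simp
    have h4 : C⁻¹ * (B + δ - (A - δ)) * η = C⁻¹ * (2 * δ) * η + C⁻¹ * (B - A) * η := by ring
    have h5 : 0 < C⁻¹ * (B - A) * η := by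
      have : 0 < B - A := by linarith
      positivity
    linarith
  have h3 := H (A - δ) (B + δ) η hη0 h1 f g hfg' t ht h2 (by rw [← hδ]; linarith)
  rw [← hδ, sub_add_cancel, add_sub_cancel_right] at h3
  calc _ < Γ * Real.exp (γ * t) * η := h3
    _ ≤ D * η := by rw [hD]; gcongr
    _ = ε₀ := by rw [hη]; field_simp

variable (S) in
/-- The mean over a finite set of initial states and a rectangle of space and time shifts. -/
noncomputable def latticeMean (τ : ℝ) (E : Finset S.State) (A : ℝ) (R N : ℕ)
    (F : S.State → ℝ) : ℝ :=
  (∑ x ∈ E ×ˢ (Finset.range R ×ˢ Finset.range N), F (S.ζ (A + x.2.1) (S.φ (x.2.2 * τ) x.1))) /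
    (E ×ˢ (Finset.range R ×ˢ Finset.range N)).card

/-- Orbits that are `2 ε` close at the times of a lattice over a larger window are
indistinguishable. -/
theorem indistinguishable_of_close {τ ε δ ε₀ : ℝ} (hτ : 0 < τ)
    (hclose : ∀ A B : ℝ, A < B → ∀ t, 0 ≤ t → t ≤ τ → ∀ f g : S.State,
      S.wdist (A - δ) (B + δ) f g < 2 * ε → S.wdist A B (S.φ t f) (S.φ t g) < ε₀)
    {A B A' B' T D : ℝ} {n M : ℕ} (hδ : 0 ≤ δ) (hAB : A < B) (hA : A' ≤ A - δ) (hB : B + δ ≤ B')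
    (hT : T + n * τ ≤ 0) (hD : D ≤ T + M * τ) {f g : S.State}
    (h : ∀ k, n ≤ k → k < M → S.wdist A' B' (S.φ (T + k * τ) f) (S.φ (T + k * τ) g) < 2 * ε) :
    S.Indistinguishable A B D ε₀ f g := by
  rintro s ⟨hs0, hsD⟩
  have hnn : (0 : ℝ) ≤ n * τ := by positivity
  have hsT : 0 ≤ (s - T) / τ := div_nonneg (by linarith) hτ.le
  -- The last lattice time before `s` is at most `τ` away, within reach of the uniform modulus.
  set k := ⌊(s - T) / τ⌋₊ with hk
  have h1 : k * τ ≤ s - T := by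
    have := Nat.floor_le hsT
    rwa [le_div_iff₀ hτ] at this
  have h2 : s - T ≤ (k + 1) * τ := by
    have := (Nat.lt_floor_add_one ((s - T) / τ)).le
    rwa [div_le_iff₀ hτ] at this
  have hnk : n ≤ k := by
    refine Nat.le_floor ?_
    rw [le_div_iff₀ hτ]
    linarith
  have hkM : k < M := by
    rw [hk, Nat.floor_lt hsT, div_lt_iff₀ hτ]
    linarith
  have h3 := hclose A B hAB (s - T - k * τ) (by linarith) (by linarith) _ _
    ((wdist_mono hA (by linarith) hB _ _).trans_lt (h k hnk hkM))
  rwa [← φ_add, ← φ_add, show s - T - k * τ + (T + k * τ) = s by ring] at h3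

/-- The terms outside the inner rectangle are each bounded by `B`. -/
theorem sum_le_sum_subrectangle {h : ℕ → ℕ → ℝ} {B : ℝ} (hB : ∀ m k, h m k ≤ B) {u v R N H : ℕ}
    (hu : H + R ≤ u) (hv : H + N ≤ v) :
    ∑ m ∈ Finset.range u, ∑ k ∈ Finset.range v, h m k ≤
      ∑ m ∈ Finset.range R, ∑ k ∈ Finset.range N, h (H + m) (H + k) + (u * v - R * N) * B := by
  have hsub : Finset.Ico H (H + R) ×ˢ Finset.Ico H (H + N) ⊆
      Finset.range u ×ˢ Finset.range v := by
    intro x hx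
    simp only [Finset.mem_product, Finset.mem_Ico, Finset.mem_range] at hx ⊢
    omega
  have h1 := Finset.sum_le_sum_of_subset_of_nonneg (f := fun x : ℕ × ℕ => B - h x.1 x.2) hsub
    fun x _ _ => sub_nonneg.2 (hB x.1 x.2)
  rw [Finset.sum_sub_distrib, Finset.sum_sub_distrib, Finset.sum_product, Finset.sum_product,
    Finset.sum_product, Finset.sum_product, Finset.sum_Ico_eq_sum_range _ H (H + R),
    Finset.sum_Ico_eq_sum_range _ H (H + R)] at h1
  simp only [Finset.sum_Ico_eq_sum_range, add_tsub_cancel_left, Finset.sum_const,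
    Finset.card_range, Nat.card_Ico, nsmul_eq_mul] at h1
  linarith

/-- Lower bound for the lattice mean of the cost of coding a tile, shifted arbitrarily. -/
theorem TileCode.CodesWithin.exists_le_latticeMean {τ ε δ ε₀ α c : ℝ} {L n : ℕ} {Ω : Type*}
    [Fintype Ω] {W : S.TileCode τ ε α L n Ω} {G : S.State → ℝ} (hW : W.CodesWithin G) {q : ℕ}
    (hq : S.GluesWith q) (hq0 : 0 < q) (hτ : 0 < τ) (hε : 0 < ε) (hδ : 0 ≤ δ)
    (hclose : ∀ A B : ℝ, A < B → ∀ t, 0 ≤ t → t ≤ τ → ∀ f g : S.State,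
      S.wdist (A - δ) (B + δ) f g < 2 * ε → S.wdist A B (S.φ t f) (S.φ t g) < ε₀)
    (hL : 0 < L) (hn : 0 < n) {B : ℝ} (hB : ∀ f, G f ≤ B) (y₀ t₀ : ℝ) :
    ∃ H : ℕ, ∀ (E : Finset S.State) (A : ℝ) (R N : ℕ), 0 < R → 0 < N → E.Nonempty →
      (∀ f ∈ E, ∀ g ∈ E, S.Indistinguishable A (A + R) (N * τ) ε₀ f g → f = g) →
      c * (R * N * τ) ≤ Real.logb 2 E.card →
      ∃ u v : ℕ, R ≤ u ∧ u ≤ R + H ∧ N ≤ v ∧ v ≤ N + H ∧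
        c * τ * L * n + B - (u * v / (R * N)) * (Real.logb 2 W.kraft + n * Real.logb 2 q + B) ≤
          S.latticeMean τ E A R N fun f => G (S.ζ y₀ (S.φ t₀ f)) := by
  -- The margin `H` absorbs the offset of the tile, the prescribed shift by `y₀` and `t₀`, the loss
  -- `δ` and one tile of array displacement. It depends on the code and the shift but not on `E`, so
  -- its relative effect vanishes for large boxes.
  obtain ⟨H, hH⟩ := exists_nat_ge (|α| + |y₀| + δ + L + n + |t₀| / τ)
  have hH1 : |α| + |y₀| + δ + L ≤ H := by
    have : 0 ≤ |t₀| / τ := by positivity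
    have : (0 : ℝ) ≤ n := by positivity
    linarith
  have hH2 : n * τ + |t₀| ≤ H * τ := by
    have h1 : n + |t₀| / τ ≤ H := by
      have := abs_nonneg α
      have := abs_nonneg y₀
      have : (0 : ℝ) ≤ L := by positivity
      linarith
    calc n * τ + |t₀| = (n + |t₀| / τ) * τ := by field_simp
      _ ≤ _ := by gcongr
  refine ⟨2 * H + L + n, fun E A R N hR hN hE hdist hlog => ?_⟩
  have hLH : L ≤ H := by
    have := abs_nonneg α
    have := abs_nonneg y₀
    have h : (L : ℝ) ≤ H := by linarith
    exact_mod_cast h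
  set P := (R + 2 * H) / L + 1 with hP
  set Q := (N + 2 * H) / n + 1 with hQ
  have hLP1 : R + 2 * H ≤ L * P := (Nat.lt_mul_div_succ _ hL).le
  have hLP2 : L * P ≤ R + 2 * H + L := by
    have := Nat.mul_div_le (R + 2 * H) L
    rw [hP, mul_add]; omega
  have hnQ1 : N + 2 * H ≤ n * Q := (Nat.lt_mul_div_succ _ hn).le
  have hnQ2 : n * Q ≤ N + 2 * H + n := by
    have := Nat.mul_div_le (N + 2 * H) n
    rw [hQ, mul_add]; omega
  have hP2 : 2 ≤ P := by
    have : 1 ≤ (R + 2 * H) / L := (Nat.one_le_div_iff hL).2 (by omega)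
    omega
  have hR' : (0 : ℝ) < R := by exact_mod_cast hR
  have hN' : (0 : ℝ) < N := by exact_mod_cast hN
  have hLP1' : (R : ℝ) + 2 * H ≤ P * L := by
    rw [mul_comm (P : ℝ)]; exact_mod_cast hLP1
  have hnQ1' : (N : ℝ) + 2 * H ≤ (Q * n : ℕ) := by
    rw [mul_comm Q]; exact_mod_cast hnQ1
  -- With this origin, and `T` below, the array index `(H + m, H + k)` is the lattice point `(m, k)`
  -- of the mean shifted by `(y₀, t₀)`.
  set X := α + y₀ + A - H with hX
  set T := t₀ - H * τ with hT
  have hα := abs_le.1 (le_refl |α|)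
  have hy₀ := abs_le.1 (le_refl |y₀|)
  have ht₀ := abs_le.1 (le_refl |t₀|)
  have hbox := hW.card_mul_le_sum_box hq hq0 hε hL hP2 (Q := Q) X T E fun f hf g hg h => by
    refine hdist f hf g hg (indistinguishable_of_close hτ hclose hδ (by linarith) ?_ ?_ ?_ ?_ h)
    · linarith
    · have : (0 : ℝ) ≤ L := by positivity
      linarith
    · linarith
    · have h1 : ((N : ℝ) + 2 * H) * τ ≤ (Q * n : ℕ) * τ := by gcongr
      have h2 : (0 : ℝ) ≤ n * τ := by positivity
      linarith
  refine ⟨L * P, n * Q, by omega, by omega, by omega, by omega, ?_⟩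
  have hEc : (0 : ℝ) < E.card := by exact_mod_cast hE.card_pos
  have hsub : ∑ f ∈ E, ∑ m ∈ Finset.range (L * P), ∑ k ∈ Finset.range (n * Q),
        G (S.ζ (X + m - α) (S.φ (T + k * τ) f)) ≤
      ∑ f ∈ E, (∑ m ∈ Finset.range R, ∑ k ∈ Finset.range N,
        G (S.ζ y₀ (S.φ t₀ (S.ζ (A + m) (S.φ (k * τ) f)))) +
          (((L * P : ℕ) : ℝ) * (n * Q : ℕ) - R * N) * B) := by
    refine Finset.sum_le_sum fun f _ => ?_
    refine (sum_le_sum_subrectangle (H := H) (R := R) (N := N)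
      (h := fun m k => G (S.ζ (X + m - α) (S.φ (T + k * τ) f)))
      (fun m k => hB _) (by omega) (by omega)).trans_eq ?_
    congr 1
    refine Finset.sum_congr rfl fun m _ => Finset.sum_congr rfl fun k _ => ?_
    rw [φ_ζ, ← φ_add, ← ζ_add]
    congr 2
    · rw [hX]; push_cast; ring
    · congr 1; rw [hT]; push_cast; ring
  have hmean : (∑ f ∈ E, ∑ m ∈ Finset.range R, ∑ k ∈ Finset.range N,
        G (S.ζ y₀ (S.φ t₀ (S.ζ (A + m) (S.φ (k * τ) f))))) =
      E.card * (R * N) * S.latticeMean τ E A R N fun f => G (S.ζ y₀ (S.φ t₀ f)) := by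
    rw [latticeMean, Finset.sum_product, Finset.card_product, Finset.card_product,
      Finset.card_range, Finset.card_range]
    simp only [Finset.sum_product]
    push_cast
    rw [mul_div_cancel₀ _ (by positivity)]
  rw [Finset.sum_add_distrib, Finset.sum_const, nsmul_eq_mul, hmean] at hsub
  have h1 := hbox.trans hsub
  set J := S.latticeMean τ E A R N fun f => G (S.ζ y₀ (S.φ t₀ f))
  set κ := Real.logb 2 W.kraft + n * Real.logb 2 q
  have h2 : E.card * (L * n * (c * (R * N * τ))) ≤ E.card * (L * n * Real.logb 2 E.card) := by
    gcongr
  push_cast at h1 ⊢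
  have h3 : E.card * (L * n * (c * (R * N * τ)) - L * P * (n * Q) * κ) ≤
      E.card * (R * N * J + (L * P * (n * Q) - R * N) * B) := by
    calc _ ≤ E.card * (L * n * Real.logb 2 E.card) - E.card * (L * P * (n * Q) * κ) := by
          rw [mul_sub]; linarith
      _ = L * n * (E.card * (Real.logb 2 E.card - P * Q * κ)) := by ring
      _ ≤ _ := h1
      _ = _ := by ring
  have h4 := le_of_mul_le_mul_left h3 hEc
  have h5 : c * τ * L * n + B - L * P * (n * Q) / (R * N) * (κ + B) =
      (L * n * (c * (R * N * τ)) - L * P * (n * Q) * κ - (L * P * (n * Q) - R * N) * B) /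
        (R * N) := by
    field_simp
    ring
  rw [h5, div_le_iff₀ (by positivity)]
  linarith

/-- A value `c'` strictly between `c` and the entropy leaves room to round the length of the window
up to an integer and the time up to a multiple of `τ`. -/
theorem exists_distinguishable_of_lt_upperTopEntropy {τ c : ℝ} (hτ : 0 < τ) (hc : 0 < c)
    (h : ENNReal.ofReal c < S.upperTopEntropy) :
    ∃ ε₀ : ℝ, 0 < ε₀ ∧ ∀ j : ℕ, ∃ (E : Finset S.State) (A : ℝ) (R N : ℕ),
      j < R ∧ j < N ∧ E.Nonempty ∧
      (∀ f ∈ E, ∀ g ∈ E, S.Indistinguishable A (A + R) (N * τ) ε₀ f g → f = g) ∧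
      c * (R * N * τ) ≤ Real.logb 2 E.card := by
  obtain ⟨c', -, hcc', hc'⟩ := ENNReal.lt_iff_exists_real_btwn.1 h
  rw [ENNReal.ofReal_lt_ofReal_iff_of_nonneg hc.le] at hcc'
  rw [upperTopEntropy, lt_iSup_iff] at hc'
  obtain ⟨ε₀, hc'⟩ := hc'
  rw [lt_iSup_iff] at hc'
  obtain ⟨hε₀, hc'⟩ := hc'
  refine ⟨ε₀, hε₀, fun j => ?_⟩
  have hc'0 : 0 < c' := hc.trans hcc'
  -- Each rounding costs a factor at most `1 + θ` once length and time are large; `θ ≤ 1` gives `(1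
  -- + θ) ^ 2 ≤ 1 + 3 * θ ≤ c' / c`.
  set θ := min 1 ((c' / c - 1) / 3) with hθ
  have hθ0 : 0 < θ := by
    refine lt_min one_pos (div_pos (sub_pos.2 ?_) three_pos)
    rwa [one_lt_div hc]
  have hθ2 : c * ((1 + θ) * (1 + θ)) ≤ c' := by
    have h1 : θ ≤ 1 := min_le_left _ _
    have h2 : θ ≤ (c' / c - 1) / 3 := min_le_right _ _
    have h3 : (1 + θ) * (1 + θ) ≤ c' / c := by nlinarith
    rw [mul_comm]
    rwa [le_div_iff₀ hc] at h3
  have hlarge : ∀ᶠ Λ : ℝ × ℝ in windowsToInfinity, max ((j : ℝ) + 1) θ⁻¹ ≤ Λ.2 - Λ.1 :=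
    tendsto_comap.eventually (eventually_ge_atTop _)
  obtain ⟨⟨a, b⟩, hΛ, hl⟩ := ((frequently_lt_of_lt_limsup (by isBoundedDefault) hc').and_eventually
    hlarge).exists
  simp only at hΛ hl
  set l := b - a with hldef
  have hl1 : (j : ℝ) + 1 ≤ l := (le_max_left _ _).trans hl
  have hl2 : θ⁻¹ ≤ l := (le_max_right _ _).trans hl
  have hl0 : 0 < l := lt_of_lt_of_le (by positivity) hl1
  rw [ENNReal.lt_div_iff_mul_lt (Or.inl (by simpa using hl0)) (Or.inl ENNReal.ofReal_ne_top),
    ← ENNReal.ofReal_mul hc'0.le] at hΛ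
  obtain ⟨T, hT, hT1⟩ := ((frequently_lt_of_lt_limsup (by isBoundedDefault) hΛ).and_eventually
    (eventually_ge_atTop (max ((j + 1) * τ) (τ * θ⁻¹)))).exists
  have hT2 : (j + 1) * τ ≤ T := (le_max_left _ _).trans hT1
  have hT3 : τ * θ⁻¹ ≤ T := (le_max_right _ _).trans hT1
  have hT0 : 0 < T := lt_of_lt_of_le (by positivity) hT2
  rw [ENNReal.lt_div_iff_mul_lt (Or.inl (by simpa using hT0)) (Or.inl ENNReal.ofReal_ne_top),
    ← ENNReal.ofReal_mul (by positivity)] at hT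
  set x := (2 : ℝ) ^ (c' * l * T) with hx
  have hx0 : 0 < x := Real.rpow_pos_of_pos two_pos _
  have hk0 : 0 < ⌈x⌉₊ := Nat.ceil_pos.2 hx0
  have hle : ((⌈x⌉₊ : ℕ) : ℕ∞) ≤ S.maxOrbits a b T ε₀ := by
    by_cases htop : S.maxOrbits a b T ε₀ = ⊤
    · rw [htop]; exact le_top
    · rw [log₂card, if_neg htop, ENNReal.ofReal_lt_ofReal_iff_of_nonneg (by positivity)] at hT
      rw [← ENat.natCast_toNat htop]
      refine ENat.natCast_le_natCast.2 (Nat.ceil_le.2 ?_)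
      have hne : (0 : ℝ) < (S.maxOrbits a b T ε₀).toNat := by
        rcases Nat.eq_zero_or_pos (S.maxOrbits a b T ε₀).toNat with h0 | h0
        · rw [h0, Nat.cast_zero, Real.logb_zero] at hT
          have : 0 < c' * l * T := by positivity
          linarith
        · exact_mod_cast h0
      rw [hx]
      exact ((Real.lt_logb_iff_rpow_lt one_lt_two hne).1 hT).le
  -- The supremum may be infinite or unattained. A strict inequality selects one separated set with
  -- at least `⌈x⌉₊` elements, which is then trimmed to a finite one.
  have hlt : ((⌈x⌉₊ - 1 : ℕ) : ℕ∞) < S.maxOrbits a b T ε₀ :=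
    lt_of_lt_of_le (by exact_mod_cast (by omega : ⌈x⌉₊ - 1 < ⌈x⌉₊)) hle
  rw [maxOrbits, lt_iSup_iff] at hlt
  obtain ⟨D, hlt⟩ := hlt
  rw [lt_iSup_iff] at hlt
  obtain ⟨hD, hlt⟩ := hlt
  have hDcard : ((⌈x⌉₊ : ℕ) : ℕ∞) ≤ D.encard := by
    have := Order.add_one_le_of_lt hlt
    have h2 : ((⌈x⌉₊ : ℕ) : ℕ∞) = ((⌈x⌉₊ - 1 : ℕ) : ℕ∞) + 1 := by
      exact_mod_cast (Nat.sub_add_cancel hk0).symm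
    rwa [h2]
  obtain ⟨D', hD'D, hD'⟩ := Set.exists_subset_encard_eq hDcard
  have hfin : D'.Finite := Set.finite_of_encard_eq_coe hD'
  have hcard : hfin.toFinset.card = ⌈x⌉₊ := by
    rw [hfin.encard_eq_coe_toFinset_card] at hD'
    exact_mod_cast hD'
  have hR1 : l ≤ ⌈l⌉₊ := Nat.le_ceil l
  have hR2 : (⌈l⌉₊ : ℝ) ≤ l + 1 := (Nat.ceil_lt_add_one hl0.le).le
  have hN1 : T ≤ ⌈T / τ⌉₊ * τ := by
    have := Nat.le_ceil (T / τ)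
    rwa [div_le_iff₀ hτ] at this
  have hN2 : ⌈T / τ⌉₊ * τ ≤ T + τ := by
    have := (Nat.ceil_lt_add_one (by positivity : 0 ≤ T / τ)).le
    calc _ ≤ (T / τ + 1) * τ := by gcongr
      _ = _ := by field_simp
  refine ⟨hfin.toFinset, a, ⌈l⌉₊, ⌈T / τ⌉₊, ?_, ?_, ?_, ?_, ?_⟩
  · rw [Nat.lt_ceil]; linarith
  · rw [Nat.lt_ceil, lt_div_iff₀ hτ]
    nlinarith
  · rw [← Finset.card_pos, hcard]; exact hk0
  · intro f hf g hg hfg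
    rw [Set.Finite.mem_toFinset] at hf hg
    by_contra hne
    refine hD (hD'D hf) (hD'D hg) hne fun t ht => ?_
    refine (wdist_mono le_rfl (by linarith) (by linarith) _ _).trans_lt
      (hfg t ⟨ht.1, ht.2.trans_le hN1⟩)
  · rw [hcard, Real.le_logb_iff_rpow_le one_lt_two (by exact_mod_cast hk0)]
    refine le_trans ?_ (Nat.le_ceil x)
    rw [hx]
    refine Real.rpow_le_rpow_of_exponent_le one_lt_two.le ?_
    have h1 : (⌈l⌉₊ : ℝ) ≤ l * (1 + θ) := by
      have : 1 ≤ l * θ := by rwa [inv_le_iff_one_le_mul₀ hθ0] at hl2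
      linarith
    have h2 : (⌈T / τ⌉₊ : ℝ) * τ ≤ T * (1 + θ) := by
      have : τ ≤ T * θ := by rwa [← div_eq_mul_inv, div_le_iff₀ hθ0] at hT3
      linarith
    calc c * (⌈l⌉₊ * ⌈T / τ⌉₊ * τ) = c * (⌈l⌉₊ * (⌈T / τ⌉₊ * τ)) := by ring
      _ ≤ c * ((l * (1 + θ)) * (T * (1 + θ))) := by gcongr
      _ = c * ((1 + θ) * (1 + θ)) * (l * T) := by ring
      _ ≤ c' * (l * T) := by gcongr
      _ = _ := by ring

end ExtendedSystem

/-! ### Kraft sums of the complexity -/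

namespace ComplexityFunction

variable {K : ComplexityFunction}

/-- The Kraft sum of the complexity over words of length `n` grows at most linearly. -/
theorem exists_kraft_sum_le (hH3 : K.Shannon) (hH4 : K.Counting) (r : ℕ) :
    ∃ D : ℝ, 0 < D ∧ ∀ n : ℕ,
      ∑ ω : Fin n → Fin r, (2 : ℝ) ^ (-(K r (List.ofFn ω) : ℝ)) ≤ D * (n + 1) := by
  obtain ⟨B, hB⟩ := hH3.exists_linear_bound r
  refine ⟨2 * (B + 1), by positivity, fun n => ?_⟩
  set M := ⌊(B : ℝ) * (n + 1)⌋₊ with hM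
  -- By (H4) at most `2 ^ (k + 1)` words have integer part of complexity `k`, each contributing at
  -- most `2 ^ (-k)`. So each level contributes at most `2`, and the number of levels is linear in
  -- `n`.
  let level : (Fin n → Fin r) → ℕ := fun ω => ⌊(K r (List.ofFn ω) : ℝ)⌋₊
  have hlevel : ∀ ω ∈ (Finset.univ : Finset (Fin n → Fin r)), level ω ∈ Finset.range (M + 1) := by
    intro ω _
    rw [Finset.mem_range, Nat.lt_succ_iff]
    refine Nat.floor_le_floor ?_
    simpa using hB (List.ofFn ω)
  have hfiber : ∀ k ∈ Finset.range (M + 1),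
      ∑ ω with level ω = k, (2 : ℝ) ^ (-(K r (List.ofFn ω) : ℝ)) ≤ 2 := by
    intro k _
    have hcard : ((Finset.univ.filter fun ω : Fin n → Fin r => level ω = k).card : ℝ) ≤
        2 ^ ((k : ℝ) + 1) := by
      obtain ⟨hfin, hle⟩ := hH4 r ((k : ℝ) + 1)
      refine le_trans ?_ hle
      rw [Set.ncard_eq_toFinset_card _ hfin]
      refine Nat.cast_le.2 (Finset.card_le_card_of_injOn List.ofFn ?_
        List.ofFn_injective.injOn)
      intro ω hω
      simp only [Finset.coe_filter, Finset.mem_univ, true_and] at hω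
      have hω' : level ω = k := hω
      rw [Set.Finite.coe_toFinset]
      change (K r (List.ofFn ω) : ℝ) < k + 1
      rw [← hω']
      exact Nat.lt_floor_add_one _
    have hterm : ∀ ω ∈ Finset.univ.filter (fun ω : Fin n → Fin r => level ω = k),
        (2 : ℝ) ^ (-(K r (List.ofFn ω) : ℝ)) ≤ 2 ^ (-(k : ℝ)) := by
      intro ω hω
      refine Real.rpow_le_rpow_of_exponent_le one_lt_two.le (neg_le_neg ?_)
      rw [← (Finset.mem_filter.1 hω).2]
      exact Nat.floor_le (NNReal.coe_nonneg _)
    calc _ ≤ _ := Finset.sum_le_card_nsmul _ _ _ hterm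
      _ ≤ 2 ^ ((k : ℝ) + 1) * 2 ^ (-(k : ℝ)) := by
        rw [nsmul_eq_mul]
        gcongr
      _ = 2 := by
        rw [← Real.rpow_add two_pos]
        norm_num
  rw [← Finset.sum_fiberwise_of_maps_to hlevel]
  refine (Finset.sum_le_card_nsmul _ _ _ hfiber).trans ?_
  rw [Finset.card_range, nsmul_eq_mul]
  have h1 : (M : ℝ) ≤ B * (n + 1) := Nat.floor_le (by positivity)
  have h2 : (0 : ℝ) ≤ n := by positivity
  push_cast
  nlinarith

end ComplexityFunction

/-! ### The limiting invariant measure -/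

namespace ExtendedSystem

variable {S : ExtendedSystem} {K : ComplexityFunction}

/-- An invariant measure for which coding any tile is at least as expensive, on average, as
prescribed by the topological entropy. -/
theorem exists_invariant_measure_cost_le (hA1 : S.WindowsCompact) (hA3 : S.SeparationBound)
    {q : ℕ} (hq : S.GluesWith q) (hq0 : 0 < q) {τ c : ℝ} (hτ : 0 < τ) (hc : 0 < c)
    (h : ENNReal.ofReal c < S.upperTopEntropy) :
    ∃ (ε : ℝ) (μ : Measure S.State), 0 < ε ∧ IsProbabilityMeasure μ ∧ S.IsInvariant μ ∧
      ∀ (α : ℝ) (L n : ℕ) (Ω : Type) [Fintype Ω] (W : S.TileCode τ ε α L n Ω)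
        (G : S.State → ℝ), 0 < L → 0 < n → Continuous G → W.CodesWithin G →
        c * τ * L * n - (Real.logb 2 W.kraft + n * Real.logb 2 q) ≤ ∫ f, G f ∂μ := by
  have hcompact := compactSpace hA1
  obtain ⟨ε₀, hε₀, hE⟩ := exists_distinguishable_of_lt_upperTopEntropy hτ hc h
  choose E A R N hR hN hEne hdist hlog using hE
  obtain ⟨ε, δ, hε, hδ, hclose⟩ := hA3.exists_close τ hε₀
  let act : ℝ × ℝ → S.State → S.State := fun a f => S.ζ a.1 (S.φ a.2 f)
  obtain ⟨μ, hμ, hinv, hint⟩ := exists_invariant_measure act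
    (fun a => (continuous_ζ a.1).comp (hA3.continuous_φ hA1 a.2))
    (fun a b f => by simp only [act, Prod.fst_add, Prod.snd_add, ζ_add, φ_add, φ_ζ])
    (J := fun j => S.latticeMean τ (E j) (A j) (R j) (N j)) fun j => by
      refine isMean_finset_average ?_ fun x : S.State × ℕ × ℕ =>
        S.ζ (A j + x.2.1) (S.φ (x.2.2 * τ) x.1)
      refine (hEne j).product (Finset.Nonempty.product ?_ ?_) <;> rw [Finset.nonempty_range_iff]
      · have := hR j; omega
      · have := hN j; omega
  refine ⟨ε, μ, hε, hμ, ⟨fun y => ?_, fun t => ?_⟩, ?_⟩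
  · have h1 : act (y, 0) = S.ζ y := funext fun f => by simp [act, φ_zero]
    exact h1 ▸ hinv (y, 0)
  · have h1 : act (0, t) = S.φ t := funext fun f => by simp [act, ζ_zero]
    exact h1 ▸ hinv (0, t)
  intro α L n Ω _ W G hL hn hG hW
  refine hint G _ hG fun a η hη => ?_
  obtain ⟨B, hB⟩ := hG.bddFun
  obtain ⟨H, hH⟩ := hW.exists_le_latticeMean (c := c) hq hq0 hτ hε hδ hclose hL hn
    (fun f => (le_abs_self _).trans (hB f)) a.1 a.2
  set κ := Real.logb 2 W.kraft + n * Real.logb 2 q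
  -- The margins multiply the volume by a factor tending to `1`. They enter times `κ + B`, whose
  -- sign is unknown, hence the absolute value.
  have hlim : Tendsto (fun j : ℕ =>
      |κ + B| * ((1 + H / ((j : ℝ) + 1)) * (1 + H / ((j : ℝ) + 1)) - 1)) atTop (𝓝 (|κ + B| * ((1 + 0) * (1 + 0) - 1))) := by
    have h1 : Tendsto (fun j : ℕ => (H : ℝ) / ((j : ℝ) + 1)) atTop (𝓝 0) :=
      tendsto_const_nhds.div_atTop
        (tendsto_atTop_add_const_right _ _ tendsto_natCast_atTop_atTop)
    exact (((tendsto_const_nhds.add h1).mul (tendsto_const_nhds.add h1)).sub_const 1).const_mul _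
  simp only [add_zero, mul_one, sub_self, mul_zero] at hlim
  filter_upwards [hlim.eventually_lt_const hη] with j hj
  obtain ⟨u, v, hRu, huR, hNv, hvN, hle⟩ := hH (E j) (A j) (R j) (N j)
    (by have := hR j; omega) (by have := hN j; omega) (hEne j) (hdist j) (hlog j)
  refine le_trans ?_ hle
  have hj0 : (0 : ℝ) < (j : ℝ) + 1 := by positivity
  have hRj : (j : ℝ) + 1 ≤ R j := by exact_mod_cast hR j
  have hNj : (j : ℝ) + 1 ≤ N j := by exact_mod_cast hN j
  have ratio : ∀ (r w : ℕ), (j : ℝ) + 1 ≤ r → r ≤ w → w ≤ r + H →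
      1 ≤ (w : ℝ) / r ∧ (w : ℝ) / r ≤ 1 + H / ((j : ℝ) + 1) := by
    intro r w hr h1 h2
    have hr0 : (0 : ℝ) < r := hj0.trans_le hr
    have h1' : (r : ℝ) ≤ w := by exact_mod_cast h1
    have h2' : (w : ℝ) ≤ r + H := by exact_mod_cast h2
    refine ⟨(one_le_div hr0).2 h1', ?_⟩
    calc (w : ℝ) / r ≤ (r + H) / r := by gcongr
      _ = 1 + H / r := by field_simp
      _ ≤ _ := by gcongr
  obtain ⟨hu1, hu2⟩ := ratio _ _ hRj hRu huR
  obtain ⟨hv1, hv2⟩ := ratio _ _ hNj hNv hvN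
  have hρ : (u : ℝ) * v / (R j * N j) = (u / R j) * (v / N j) := by
    rw [div_mul_div_comm]
  rw [hρ]
  set ρ := (u : ℝ) / R j * (v / N j)
  have hρ1 : 1 ≤ ρ := one_le_mul_of_one_le_of_one_le hu1 hv1
  have hρ2 : ρ ≤ (1 + H / ((j : ℝ) + 1)) * (1 + H / ((j : ℝ) + 1)) := by
    simp only [ρ]
    gcongr
  have h1 : (ρ - 1) * (κ + B) ≤ |κ + B| * (ρ - 1) := by
    rw [mul_comm]
    exact mul_le_mul_of_nonneg_right (le_abs_self _) (by linarith)
  have h2 : |κ + B| * (ρ - 1) ≤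
      |κ + B| * ((1 + H / ((j : ℝ) + 1)) * (1 + H / ((j : ℝ) + 1)) - 1) := by gcongr
  linarith

/-! ### Coding with a finite family of coverings -/

section Family

variable {α ε τ : ℝ} {L p : ℕ}

/-- The words of length `n` over the alphabets of a finite family of coverings, with their
complexities as costs and the radii of the balls doubled. -/
noncomputable def familyCode (K : ComplexityFunction) (τ : ℝ) (hε : 0 < ε)
    (V : Fin p → S.Covering α (α + L) (ε / 2)) (n : ℕ) :
    S.TileCode τ ε α L n (Σ i, Fin n → Fin (V i).card) where
  cost ω := K _ (List.ofFn ω.2)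
  center ω j := if h : j < n then (V ω.1).center (ω.2 ⟨j, h⟩) else
    Classical.choice S.nonempty.to_subtype
  radius ω j := if h : j < n then 2 * (V ω.1).radius (ω.2 ⟨j, h⟩) else ε / 2
  radius_mem ω j := by
    by_cases h : j < n
    · have h1 := (V ω.1).radius_pos (ω.2 ⟨j, h⟩)
      have h2 := (V ω.1).radius_lt (ω.2 ⟨j, h⟩)
      simp only [h, dif_pos]
      constructor <;> linarith
    · simp only [h, dif_neg, not_false_eq_true]
      constructor <;> linarith

/-- How far the orbit of `f` is from being coded by `ω`. -/
noncomputable def codingDefect {b : ℝ} (U : S.Covering α b ε) (τ : ℝ) {n : ℕ}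
    (ω : Fin n → Fin U.card) (f : S.State) : ℝ :=
  ∑ j : Fin n, max 0 (S.wdist α b (S.φ (j * τ) f) (U.center (ω j)) / U.radius (ω j) - 1)

/-- A continuous substitute for the complexity of the orbit of `f`. -/
noncomputable def smoothCost (K : ComplexityFunction) (τ : ℝ)
    (V : Fin p → S.Covering α (α + L) (ε / 2)) (n : ℕ)
    (h : Nonempty (Σ i, Fin n → Fin (V i).card)) (f : S.State) : ℝ :=
  Finset.univ.inf' Finset.univ_nonempty fun ω : Σ i, Fin n → Fin (V i).card =>
    (K _ (List.ofFn ω.2) : ℝ) + (∑ ω' : Σ i, Fin n → Fin (V i).card, (K _ (List.ofFn ω'.2) : ℝ)) *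
      codingDefect (V ω.1) τ ω.2 f

theorem codingDefect_nonneg {b : ℝ} (U : S.Covering α b ε) (τ : ℝ) {n : ℕ}
    (ω : Fin n → Fin U.card) (f : S.State) : 0 ≤ codingDefect U τ ω f :=
  Finset.sum_nonneg fun _ _ => le_max_left _ _

theorem Covering.exists_codes {b : ℝ} (U : S.Covering α b ε) (τ : ℝ) (f : S.State) (n : ℕ) :
    ∃ ω, U.Codes τ f n ω := by
  choose ω hω using U.covers
  exact ⟨fun j => ω (S.φ (j * τ) f), fun j => hω _⟩

theorem continuous_smoothCost (hA1 : S.WindowsCompact) (hA3 : S.SeparationBound) (hL : 0 < L)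
    (V : Fin p → S.Covering α (α + L) (ε / 2)) (n : ℕ)
    (h : Nonempty (Σ i, Fin n → Fin (V i).card)) : Continuous (smoothCost K τ V n h) := by
  have hL' : (0 : ℝ) < L := by exact_mod_cast hL
  refine Continuous.finset_inf'_apply _ fun ω _ => ?_
  refine continuous_const.add (continuous_const.mul (continuous_finsetSum _ fun j _ => ?_))
  exact continuous_const.max ((((continuous_wdist (by linarith) _).comp
    (hA3.continuous_φ hA1 _)).div_const _).sub continuous_const)

/-- If the minimizing word follows the orbit within doubled radii, its complexity is within the
bound. Otherwise its defect is at least `1`, and the penalty, the sum of all complexities, pays for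
any genuine coding. -/
theorem codesWithin_smoothCost (hε : 0 < ε) (hp : 0 < p)
    (V : Fin p → S.Covering α (α + L) (ε / 2)) (n : ℕ)
    (h : Nonempty (Σ i, Fin n → Fin (V i).card)) :
    (familyCode K τ hε V n).CodesWithin (smoothCost K τ V n h) := by
  intro f
  obtain ⟨ω, -, hω⟩ := Finset.exists_mem_eq_inf' (Finset.univ_nonempty
    (α := Σ i, Fin n → Fin (V i).card)) (fun ω : Σ i, Fin n → Fin (V i).card =>
    (K _ (List.ofFn ω.2) : ℝ) + (∑ ω' : Σ i, Fin n → Fin (V i).card, (K _ (List.ofFn ω'.2) : ℝ)) *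
      codingDefect (V ω.1) τ ω.2 f)
  change smoothCost K τ V n h f = _ at hω
  have hsum0 : 0 ≤ ∑ ω' : Σ i, Fin n → Fin (V i).card, (K _ (List.ofFn ω'.2) : ℝ) :=
    Finset.sum_nonneg fun _ _ => NNReal.coe_nonneg _
  have hdef := codingDefect_nonneg (V ω.1) τ ω.2 f
  by_cases hfol : (familyCode K τ hε V n).Follows ω f
  · refine ⟨ω, hfol, ?_⟩
    rw [hω]
    exact le_add_of_nonneg_right (mul_nonneg hsum0 hdef)
  · obtain ⟨ω₀, hω₀⟩ := (V ⟨0, hp⟩).exists_codes τ f n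
    refine ⟨⟨⟨0, hp⟩, ω₀⟩, fun j hj => ?_, ?_⟩
    · simp only [familyCode, hj, dif_pos]
      have h1 := hω₀ ⟨j, hj⟩
      have h2 := (V ⟨0, hp⟩).radius_pos (ω₀ ⟨j, hj⟩)
      simp only at h1
      linarith
    · have h1 : 1 ≤ codingDefect (V ω.1) τ ω.2 f := by
        simp only [TileCode.Follows, not_forall, not_lt] at hfol
        obtain ⟨j, hj, hfar⟩ := hfol
        simp only [familyCode, hj, dif_pos] at hfar
        have h2 := (V ω.1).radius_pos (ω.2 ⟨j, hj⟩)
        refine le_trans ?_ (Finset.single_le_sum (f := fun j : Fin n =>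
          max 0 (S.wdist α (α + L) (S.φ (j * τ) f) ((V ω.1).center (ω.2 j)) /
            (V ω.1).radius (ω.2 j) - 1)) (fun _ _ => le_max_left _ _) (Finset.mem_univ ⟨j, hj⟩))
        refine le_max_of_le_right ?_
        rw [le_sub_iff_add_le, le_div_iff₀ h2]
        norm_num
        exact hfar
      rw [hω]
      calc (K _ (List.ofFn ω₀) : ℝ)
          ≤ ∑ ω' : Σ i, Fin n → Fin (V i).card, (K _ (List.ofFn ω'.2) : ℝ) :=
            Finset.single_le_sum (f := fun ω' : Σ i, Fin n → Fin (V i).card =>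
              (K _ (List.ofFn ω'.2) : ℝ)) (fun _ _ => NNReal.coe_nonneg _)
              (Finset.mem_univ (⟨⟨0, hp⟩, ω₀⟩ : Σ i, Fin n → Fin (V i).card))
        _ ≤ (∑ ω' : Σ i, Fin n → Fin (V i).card, (K _ (List.ofFn ω'.2) : ℝ)) *
              codingDefect (V ω.1) τ ω.2 f := le_mul_of_one_le_right hsum0 h1
        _ ≤ _ := le_add_of_nonneg_left (NNReal.coe_nonneg _)

/-- Genuine codings have defect zero, so they compete in the minimum at their plain complexity. -/
theorem smoothCost_le (V : Fin p → S.Covering α (α + L) (ε / 2)) (n : ℕ)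
    (h : Nonempty (Σ i, Fin n → Fin (V i).card)) (f : S.State) :
    ENNReal.ofReal (smoothCost K τ V n h f) ≤ ⨅ i, (V i).orbitComplexity K τ f n := by
  refine le_iInf fun i => le_iInf₂ fun ω hω => ?_
  rw [← ENNReal.ofReal_coe_nnreal]
  refine ENNReal.ofReal_le_ofReal ?_
  refine (Finset.inf'_le _ (Finset.mem_univ (⟨i, ω⟩ : Σ i, Fin n → Fin (V i).card))).trans_eq ?_
  have h1 : codingDefect (V i) τ ω f = 0 := by
    refine Finset.sum_eq_zero fun j _ => max_eq_left ?_
    have h2 := (V i).radius_pos (ω j)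
    rw [sub_nonpos, div_le_one h2]
    exact (hω j).le
  simp [h1]

theorem exists_kraft_familyCode_le (hH3 : K.Shannon) (hH4 : K.Counting) (hε : 0 < ε)
    (hp : 0 < p) (V : Fin p → S.Covering α (α + L) (ε / 2)) :
    ∃ D : ℝ, 0 < D ∧ ∀ n : ℕ, (familyCode K τ hε V n).kraft ≤ D * (n + 1) := by
  choose D hD0 hD using fun i => ComplexityFunction.exists_kraft_sum_le hH3 hH4 (V i).card
  have : Nonempty (Fin p) := ⟨⟨0, hp⟩⟩
  refine ⟨∑ i, D i, Finset.sum_pos (fun i _ => hD0 i) Finset.univ_nonempty, fun n => ?_⟩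
  rw [TileCode.kraft, Fintype.sum_sigma, Finset.sum_mul]
  exact Finset.sum_le_sum fun i _ => hD i n

end Family

end ExtendedSystem

namespace ExtendedSystem

variable {S : ExtendedSystem} {K : ComplexityFunction}

/-! ### Measurability and bounds for the complexity of orbits -/

theorem Covering.measurable_orbitComplexity (hA1 : S.WindowsCompact) (hA3 : S.SeparationBound)
    {a b ε : ℝ} (hab : a < b) (U : S.Covering a b ε) (K : ComplexityFunction) (τ : ℝ) (n : ℕ) :
    Measurable fun f => U.orbitComplexity K τ f n := by
  classical
  refine Measurable.iInf fun ω => ?_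
  have hset : MeasurableSet {f : S.State | U.Codes τ f n ω} := by
    have h1 : {f : S.State | U.Codes τ f n ω} =
        ⋂ j : Fin n, S.φ (j * τ) ⁻¹' {g | S.wdist a b g (U.center (ω j)) < U.radius (ω j)} := by
      ext f
      exact (mem_iInter (x := f) (s := fun j : Fin n =>
        S.φ (j * τ) ⁻¹' {g | S.wdist a b g (U.center (ω j)) < U.radius (ω j)})).symm
    rw [h1]
    exact MeasurableSet.iInter fun j =>
      ((isOpen_ball hab _ _).preimage (hA3.continuous_φ hA1 _)).measurableSet
  have h2 : (fun f : S.State => ⨅ _ : U.Codes τ f n ω, (K U.card (List.ofFn ω) : ℝ≥0∞)) =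
      fun f => if U.Codes τ f n ω then (K U.card (List.ofFn ω) : ℝ≥0∞) else ⊤ := by
    funext f
    split_ifs with h <;> simp [h]
  rw [h2]
  exact Measurable.ite hset measurable_const measurable_const

theorem Covering.measurable_rate (hA1 : S.WindowsCompact) (hA3 : S.SeparationBound)
    {a b ε : ℝ} (hab : a < b) (U : S.Covering a b ε) (K : ComplexityFunction) (τ : ℝ) :
    Measurable (U.rate K τ) :=
  Measurable.limsup fun n => (U.measurable_orbitComplexity hA1 hA3 hab K τ n).div_const _

/-- A constant majorant for the reverse Fatou lemma; the index `n + 1` avoids division by zero. -/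
theorem Covering.exists_orbitComplexity_div_le (hH3 : K.Shannon) {a b ε : ℝ}
    (U : S.Covering a b ε) (τ : ℝ) :
    ∃ B : ℝ≥0, ∀ (f : S.State) (n : ℕ),
      U.orbitComplexity K τ f (n + 1) / ((n + 1 : ℕ) : ℝ≥0∞) ≤ B := by
  obtain ⟨B, hB⟩ := hH3.exists_linear_bound U.card
  refine ⟨2 * B, fun f n => ?_⟩
  obtain ⟨ω, hω⟩ := U.exists_codes τ f (n + 1)
  rw [ENNReal.div_le_iff (by simp) (by simp)]
  refine (iInf₂_le ω hω).trans ?_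
  have h1 : (K U.card (List.ofFn ω) : ℝ) ≤ 2 * B * (n + 1 : ℕ) := by
    have h2 := hB (List.ofFn ω)
    rw [List.length_ofFn] at h2
    have h3 : (0 : ℝ) ≤ B := B.2
    have h4 : (0 : ℝ) ≤ n := by positivity
    push_cast at h2 ⊢
    nlinarith
  have h5 : K U.card (List.ofFn ω) ≤ 2 * B * (n + 1 : ℕ) := by exact_mod_cast h1
  exact_mod_cast h5

theorem Covering.exists_rate_le (hH3 : K.Shannon) {a b ε : ℝ} (U : S.Covering a b ε) (τ : ℝ) :
    ∃ B : ℝ≥0, ∀ f : S.State, U.rate K τ f ≤ B := by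
  obtain ⟨B, hB⟩ := U.exists_orbitComplexity_div_le hH3 τ
  refine ⟨B, fun f => ?_⟩
  rw [Covering.rate, ← limsup_nat_add _ 1]
  exact (limsup_le_limsup (Eventually.of_forall fun n => hB f n)).trans_eq (limsup_const _)

/-- A covering of a window is a covering of any smaller window. -/
def Covering.restrict {a b a' b' ε : ℝ} (U : S.Covering a b ε) (ha : a ≤ a') (h : a' < b')
    (hb : b' ≤ b) : S.Covering a' b' ε where
  card := U.card
  center := U.center
  radius := U.radius
  radius_pos := U.radius_pos
  radius_lt := U.radius_lt
  covers f := (U.covers f).imp fun _ hi => (wdist_mono ha h hb _ _).trans_lt hi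

theorem Covering.rate_restrict_le {a b a' b' ε : ℝ} (U : S.Covering a b ε) (ha : a ≤ a')
    (h : a' < b') (hb : b' ≤ b) (τ : ℝ) (f : S.State) :
    (U.restrict ha h hb).rate K τ f ≤ U.rate K τ f := by
  refine limsup_le_limsup (Eventually.of_forall fun n => ENNReal.div_le_div_right ?_ _)
  exact le_iInf₂ fun ω hω => iInf₂_le (f := fun (ω : Fin n → Fin U.card)
    (_ : (U.restrict ha h hb).Codes τ f n ω) => (K U.card (List.ofFn ω) : ℝ≥0∞)) ω
    fun j => (wdist_mono ha h hb _ _).trans_lt (hω j)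

theorem windowComplexity_mono {a b a' b' ε : ℝ} (ha : a ≤ a') (h : a' < b') (hb : b' ≤ b)
    (τ : ℝ) (f : S.State) :
    S.windowComplexity K τ ε a' b' f ≤ S.windowComplexity K τ ε a b f :=
  le_iInf fun U => (iInf_le _ (U.restrict ha h hb)).trans (U.rate_restrict_le ha h hb τ f)

/-- Countably many coverings of radius `< ε / 2` do at least as well as all coverings of radius
`< ε / 4`. -/
theorem exists_countable_coverings (hA1 : S.WindowsCompact) (K : ComplexityFunction) (τ : ℝ)
    {ε a b : ℝ} (hε : 0 < ε) (hab : a < b) :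
    ∃ V : ℕ → S.Covering a b (ε / 2), ∀ U : S.Covering a b (ε / 4), ∃ i, ∀ f,
      (V i).rate K τ f ≤ U.rate K τ f := by
  have hcompact := compactSpace hA1
  obtain ⟨t, ht⟩ := isCompact_univ.elim_finite_subcover
    (fun z : S.State => {g : S.State | S.wdist a b g z < ε / 8})
    (fun z => isOpen_ball hab z (ε / 8))
    (fun f _ => mem_iUnion.2 ⟨f, show S.wdist a b f f < ε / 8 by rw [wdist_self hab]; linarith⟩)
  have hnet : ∀ f : S.State, ∃ z : t, S.wdist a b f z.1 < ε / 8 := fun f => by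
    obtain ⟨z, hz, hf⟩ := mem_iUnion₂.1 (ht (mem_univ f))
    exact ⟨⟨z, hz⟩, hf⟩
  -- Coverings with centers in a finite net and one fixed radius form a countable type.
  let I := {x : Σ r : ℕ, Fin r → t // ∀ f : S.State, ∃ i, S.wdist a b f (x.2 i).1 < 3 * ε / 8}
  let V : I → S.Covering a b (ε / 2) := fun x =>
    { card := x.1.1
      center := fun i => (x.1.2 i).1
      radius := fun _ => 3 * ε / 8
      radius_pos := fun _ => by linarith
      radius_lt := fun _ => by linarith
      covers := x.2 }
  -- Moving each center to the net enlarges a ball to radius at most `ε / 4 + ε / 8 = 3 * ε / 8 < ε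
  -- / 2`, and every coding remains valid.
  have key : ∀ U : S.Covering a b (ε / 4), ∃ x : I, ∀ f, (V x).rate K τ f ≤ U.rate K τ f := by
    intro U
    choose σ hσ using fun i => hnet (U.center i)
    have hball : ∀ (f : S.State) (i : Fin U.card), S.wdist a b f (U.center i) < U.radius i →
        S.wdist a b f (σ i).1 < 3 * ε / 8 := by
      intro f i hi
      have h1 := wdist_triangle hab f (U.center i) (σ i).1
      have h2 := hσ i
      have h3 := U.radius_lt i
      linarith
    refine ⟨⟨⟨U.card, σ⟩, fun f => (U.covers f).imp fun i hi => hball f i hi⟩, fun f => ?_⟩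
    refine limsup_le_limsup (Eventually.of_forall fun n => ENNReal.div_le_div_right ?_ _)
    exact le_iInf₂ fun ω hω => iInf₂_le (f := fun (ω : Fin n → Fin U.card)
      (_ : (V ⟨⟨U.card, σ⟩, fun f => (U.covers f).imp fun i hi => hball f i hi⟩).Codes τ f n ω) =>
      (K U.card (List.ofFn ω) : ℝ≥0∞)) ω fun j => hball _ _ (hω j)
  have hcov : Nonempty (S.Covering a b (ε / 4)) := by
    refine ⟨⟨t.card, fun i => (t.equivFin.symm i).1, fun _ => ε / 8, fun _ => by linarith,
      fun _ => by linarith, fun f => ?_⟩⟩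
    obtain ⟨z, hz⟩ := hnet f
    exact ⟨t.equivFin z, by simpa using hz⟩
  have hI : Nonempty I := ⟨(key hcov.some).choose⟩
  obtain ⟨e, he⟩ := exists_surjective_nat I
  refine ⟨fun i => V (e i), fun U => ?_⟩
  obtain ⟨x, hx⟩ := key U
  obtain ⟨i, rfl⟩ := he x
  exact ⟨i, hx⟩

/-! ### Lower bound for the complexity of a suitable measure -/

/-- The average over `μ` of the cost of coding any tile is at least `h` per unit time step and unit
length, up to the Kraft sum and an error `q` per time step. -/
def CostBound (S : ExtendedSystem) (μ : Measure S.State) (τ ε h q : ℝ) : Prop :=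
  ∀ (α : ℝ) (L n : ℕ) (Ω : Type) [Fintype Ω] (W : S.TileCode τ ε α L n Ω) (G : S.State → ℝ),
    0 < L → 0 < n → Continuous G → W.CodesWithin G →
      h * L * n - (Real.logb 2 W.kraft + n * q) ≤ ∫ f, G f ∂μ

variable {μ : Measure S.State} [IsProbabilityMeasure μ] {τ ε h q : ℝ}

/-- The infimum over the family stays inside the integral, since different orbits may be best coded
by different coverings. This is why the code uses the words of all coverings at once. -/
theorem CostBound.le_lintegral_iInf_orbitComplexity (hμ : CostBound S μ τ ε h q)
    (hA1 : S.WindowsCompact) (hA3 : S.SeparationBound) (hε : 0 < ε) {α : ℝ} {L p n : ℕ}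
    (hL : 0 < L) (hp : 0 < p) (hn : 0 < n) (V : Fin p → S.Covering α (α + L) (ε / 2)) :
    ENNReal.ofReal (h * L * n - (Real.logb 2 (familyCode K τ hε V n).kraft + n * q)) ≤
      ∫⁻ f, ⨅ i, (V i).orbitComplexity K τ f n ∂μ := by
  have hcompact := compactSpace hA1
  have hΩ : Nonempty (Σ i, Fin n → Fin (V i).card) := by
    obtain ⟨f⟩ : Nonempty S.State := S.nonempty.to_subtype
    exact ⟨⟨⟨0, hp⟩, ((V ⟨0, hp⟩).exists_codes τ f n).choose⟩⟩
  have hcont : Continuous (smoothCost K τ V n hΩ) := continuous_smoothCost hA1 hA3 hL V n hΩ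
  have h1 := hμ α L n _ (familyCode K τ hε V n) _ hL hn hcont
    (codesWithin_smoothCost hε hp V n hΩ)
  have h0 : ∀ f, 0 ≤ smoothCost K τ V n hΩ f := fun f =>
    Finset.le_inf' _ _ fun ω _ => add_nonneg (NNReal.coe_nonneg _)
      (mul_nonneg (Finset.sum_nonneg fun _ _ => NNReal.coe_nonneg _) (codingDefect_nonneg _ _ _ _))
  have hint : Integrable (smoothCost K τ V n hΩ) μ := by
    obtain ⟨C, hC⟩ := hcont.bddFun
    exact Integrable.of_bound hcont.measurable.aestronglyMeasurable C
      (Eventually.of_forall hC)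
  refine (ENNReal.ofReal_le_ofReal h1).trans ?_
  rw [ofReal_integral_eq_lintegral_ofReal hint (Eventually.of_forall h0)]
  exact lintegral_mono fun f => smoothCost_le V n hΩ f

/-- After division by `n` the logarithm of the Kraft sum vanishes. Reverse Fatou brings the upper
limit inside the integral, where the upper limit of the minima is at most the minimum of the upper
limits. -/
theorem CostBound.le_lintegral_iInf_rate (hμ : CostBound S μ τ ε h q)
    (hA1 : S.WindowsCompact) (hA3 : S.SeparationBound) (hH3 : K.Shannon) (hH4 : K.Counting)
    (hε : 0 < ε) {α : ℝ} {L p : ℕ} (hL : 0 < L) (hp : 0 < p)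
    (V : Fin p → S.Covering α (α + L) (ε / 2)) :
    ENNReal.ofReal (h * L - q) ≤ ∫⁻ f, ⨅ i, (V i).rate K τ f ∂μ := by
  have hL' : (0 : ℝ) < L := by exact_mod_cast hL
  obtain ⟨D, hD0, hD⟩ := exists_kraft_familyCode_le (τ := τ) hH3 hH4 hε hp V
  obtain ⟨B, hB⟩ := (V ⟨0, hp⟩).exists_orbitComplexity_div_le hH3 τ
  have hmeas : ∀ n : ℕ, Measurable fun f =>
      (⨅ i, (V i).orbitComplexity K τ f (n + 1)) / ((n + 1 : ℕ) : ℝ≥0∞) := fun n =>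
    (Measurable.iInf fun i =>
      (V i).measurable_orbitComplexity hA1 hA3 (by linarith) K τ (n + 1)).div_const _
  have hfatou := limsup_lintegral_le (μ := μ) (fun _ => (B : ℝ≥0∞)) hmeas
    (fun n => Eventually.of_forall fun f =>
      (ENNReal.div_le_div_right (iInf_le _ ⟨0, hp⟩) _).trans (hB f n)) (by simp)
  have hlim : Tendsto (fun n : ℕ => h * L - (Real.logb 2 D / ((n + 1 : ℕ) : ℝ) +
      Real.logb 2 (((n + 1 : ℕ) : ℝ) + 1) / ((n + 1 : ℕ) : ℝ) + q)) atTop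
      (𝓝 (h * L - (0 + 0 + q))) := by
    have h1 : Tendsto (fun n : ℕ => Real.logb 2 D / (n : ℝ)) atTop (𝓝 0) :=
      tendsto_const_div_atTop_nhds_zero_nat _
    exact tendsto_const_nhds.sub ((((tendsto_add_atTop_iff_nat 1).2 h1).add
      ((tendsto_add_atTop_iff_nat 1).2 ComplexityFunction.tendsto_logb_div)).add_const q)
  simp only [zero_add] at hlim
  have hlower : ∀ n : ℕ, ENNReal.ofReal (h * L - (Real.logb 2 D / ((n + 1 : ℕ) : ℝ) +
      Real.logb 2 (((n + 1 : ℕ) : ℝ) + 1) / ((n + 1 : ℕ) : ℝ) + q)) ≤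
      ∫⁻ f, (⨅ i, (V i).orbitComplexity K τ f (n + 1)) / ((n + 1 : ℕ) : ℝ≥0∞) ∂μ := by
    intro n
    have hn : (0 : ℝ) < ((n + 1 : ℕ) : ℝ) := by positivity
    have h1 := hμ.le_lintegral_iInf_orbitComplexity (K := K) hA1 hA3 hε hL hp n.succ_pos V
    have hΩ : Nonempty (Σ i, Fin (n + 1) → Fin (V i).card) := by
      obtain ⟨f⟩ : Nonempty S.State := S.nonempty.to_subtype
      exact ⟨⟨⟨0, hp⟩, ((V ⟨0, hp⟩).exists_codes τ f (n + 1)).choose⟩⟩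
    have h2 : Real.logb 2 (familyCode K τ hε V (n + 1)).kraft ≤
        Real.logb 2 D + Real.logb 2 (((n + 1 : ℕ) : ℝ) + 1) := by
      rw [← Real.logb_mul hD0.ne' (by positivity)]
      exact Real.logb_le_logb_of_le one_lt_two (TileCode.kraft_pos _) (hD (n + 1))
    simp only [div_eq_mul_inv]
    rw [lintegral_mul_const' _ _ (by simp), ← div_eq_mul_inv _ (((n + 1 : ℕ) : ℝ≥0∞)),
      ENNReal.le_div_iff_mul_le (by simp) (by simp), ← ENNReal.ofReal_natCast,
      ← ENNReal.ofReal_mul' hn.le]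
    refine le_trans (ENNReal.ofReal_le_ofReal ?_) h1
    have h3 : (h * L - (Real.logb 2 D * (((n + 1 : ℕ) : ℝ))⁻¹ +
        Real.logb 2 (((n + 1 : ℕ) : ℝ) + 1) * (((n + 1 : ℕ) : ℝ))⁻¹ + q)) * ((n + 1 : ℕ) : ℝ) =
        h * L * (n + 1 : ℕ) - (Real.logb 2 D + Real.logb 2 (((n + 1 : ℕ) : ℝ) + 1) +
          (n + 1 : ℕ) * q) := by
      field_simp
    rw [h3]
    simp only [Nat.succ_eq_add_one]
    linarith
  calc ENNReal.ofReal (h * L - q)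
      = limsup (fun n : ℕ => ENNReal.ofReal (h * L - (Real.logb 2 D / ((n + 1 : ℕ) : ℝ) +
          Real.logb 2 (((n + 1 : ℕ) : ℝ) + 1) / ((n + 1 : ℕ) : ℝ) + q))) atTop :=
        ((ENNReal.continuous_ofReal.tendsto _).comp hlim).limsup_eq.symm
    _ ≤ limsup (fun n : ℕ => ∫⁻ f, (⨅ i, (V i).orbitComplexity K τ f (n + 1)) /
          ((n + 1 : ℕ) : ℝ≥0∞) ∂μ) atTop := limsup_le_limsup (Eventually.of_forall hlower)
    _ ≤ _ := hfatou
    _ ≤ _ := by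
      refine lintegral_mono fun f => le_iInf fun i => ?_
      rw [Covering.rate, ← limsup_nat_add (fun n : ℕ => (V i).orbitComplexity K τ f n / n) 1]
      exact limsup_le_limsup (Eventually.of_forall fun n =>
        ENNReal.div_le_div_right (iInf_le _ i) _)

theorem CostBound.le_lintegral_iInf_rate_nat (hμ : CostBound S μ τ ε h q)
    (hA1 : S.WindowsCompact) (hA3 : S.SeparationBound) (hH3 : K.Shannon) (hH4 : K.Counting)
    (hε : 0 < ε) {α : ℝ} {L : ℕ} (hL : 0 < L) (V : ℕ → S.Covering α (α + L) (ε / 2)) :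
    ENNReal.ofReal (h * L - q) ≤ ∫⁻ f, ⨅ i, (V i).rate K τ f ∂μ := by
  have hL' : (0 : ℝ) < L := by exact_mod_cast hL
  have hmeas : ∀ i, Measurable ((V i).rate K τ) := fun i =>
    (V i).measurable_rate hA1 hA3 (by linarith) K τ
  -- Minima over initial segments decrease to the infimum, so the finite case passes to the limit by
  -- monotone convergence.
  have h1 : ∀ f : S.State, ⨅ i, (V i).rate K τ f =
      ⨅ p : ℕ, ⨅ i : Fin (p + 1), (V i).rate K τ f := by
    intro f
    refine le_antisymm (le_iInf₂ fun p i => iInf_le _ _) (le_iInf fun i => ?_)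
    exact (iInf_le _ i).trans (iInf_le (fun k : Fin (i + 1) => (V k).rate K τ f) (Fin.last i))
  simp only [h1]
  rw [lintegral_iInf]
  · exact le_iInf fun p =>
      hμ.le_lintegral_iInf_rate hA1 hA3 hH3 hH4 hε hL p.succ_pos fun i => V i
  · exact fun p => Measurable.iInf fun i => hmeas i
  · intro p p' hpp' f
    exact le_iInf fun i => iInf_le (fun k : Fin (p' + 1) => (V k).rate K τ f)
      ⟨i, by have := i.2; omega⟩
  · obtain ⟨B, hB⟩ := (V 0).exists_rate_le hH3 τ
    refine ne_top_of_le_ne_top (b := ∫⁻ _, (B : ℝ≥0∞) ∂μ) (by simp) (lintegral_mono fun f => ?_)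
    exact (iInf_le (fun k : Fin (0 + 1) => (V k).rate K τ f) 0).trans (hB f)

theorem CostBound.le_lintegral_pointComplexity (hμ : CostBound S μ τ ε h q)
    (hA1 : S.WindowsCompact) (hA2 : S.BallsGlue) (hA3 : S.SeparationBound) (hH1 : K.Concat)
    (hH3 : K.Shannon) (hH4 : K.Counting) (hε : 0 < ε) (hh : 0 ≤ h) {a b : ℕ → ℝ}
    (hab : AdmissibleWindows a b) :
    ENNReal.ofReal h ≤ ∫⁻ f, S.pointComplexity K τ (ε / 4) a b f ∂μ := by
  -- Windows shorter than `1` are discarded, so that the integer part of the length is positive.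
  obtain ⟨k₀, hk₀⟩ := eventually_atTop.1 (hab.length.eventually_ge_atTop 1)
  set l : ℕ → ℝ := fun k => b (k + k₀) - a (k + k₀) with hl
  have hl1 : ∀ k, 1 ≤ l k := fun k => hk₀ (k + k₀) (by omega)
  have hl0 : ∀ k, 0 < l k := fun k => one_pos.trans_le (hl1 k)
  have hL : ∀ k, 0 < ⌊l k⌋₊ := fun k => Nat.floor_pos.2 (hl1 k)
  have hLl : ∀ k, (⌊l k⌋₊ : ℝ) ≤ l k := fun k => Nat.floor_le (hl0 k).le
  have hL' : ∀ k, (0 : ℝ) < ⌊l k⌋₊ := fun k => by exact_mod_cast hL k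
  choose V hV using fun k => exists_countable_coverings hA1 K τ hε
    (by linarith [hL' k] : a (k + k₀) < a (k + k₀) + ⌊l k⌋₊)
  obtain ⟨B, hB⟩ := exists_windowComplexity_le (K := K) hA1 hA2 hH1 hH3 τ
    (by linarith : 0 < ε / 4)
  have hVW : ∀ k f, ⨅ i, (V k i).rate K τ f ≤
      S.windowComplexity K τ (ε / 4) (a (k + k₀)) (a (k + k₀) + ⌊l k⌋₊) f := fun k f =>
    le_iInf fun U => by
      obtain ⟨i, hi⟩ := hV k U
      exact (iInf_le _ i).trans (hi f)
  have hmeas : ∀ k, Measurable fun f => (⨅ i, (V k i).rate K τ f) / ENNReal.ofReal (l k) :=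
    fun k => (Measurable.iInf fun i =>
      (V k i).measurable_rate hA1 hA3 (by linarith [hL' k]) K τ).div_const _
  have hfatou := limsup_lintegral_le (μ := μ) (fun _ => (B : ℝ≥0∞)) hmeas
    (fun k => Eventually.of_forall fun f => by
      rw [ENNReal.div_le_iff (by simpa using hl0 k) ENNReal.ofReal_ne_top]
      refine ((hVW k f).trans (hB _ _ (hL k) f)).trans ?_
      gcongr
      rw [← ENNReal.ofReal_natCast]
      exact ENNReal.ofReal_le_ofReal (hLl k)) (by simp)
  have hllim : Tendsto l atTop atTop := (tendsto_add_atTop_iff_nat k₀).2 hab.length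
  -- Truncating the length to an integer loses at most `h` and gluing loses `q`; both are negligible
  -- per unit length.
  have hlim : Tendsto (fun k => h - (h + q) * (l k)⁻¹) atTop (𝓝 (h - (h + q) * 0)) :=
    tendsto_const_nhds.sub ((tendsto_inv_atTop_zero.comp hllim).const_mul _)
  rw [mul_zero, sub_zero] at hlim
  calc ENNReal.ofReal h = limsup (fun k => ENNReal.ofReal (h - (h + q) * (l k)⁻¹)) atTop :=
        ((ENNReal.continuous_ofReal.tendsto _).comp hlim).limsup_eq.symm
    _ ≤ limsup (fun k => ∫⁻ f, (⨅ i, (V k i).rate K τ f) / ENNReal.ofReal (l k) ∂μ) atTop := by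
      refine limsup_le_limsup (Eventually.of_forall fun k => ?_)
      have h1 := hμ.le_lintegral_iInf_rate_nat (K := K) hA1 hA3 hH3 hH4 hε (hL k) (V k)
      have h2 : (ENNReal.ofReal (l k))⁻¹ ≠ ⊤ := by simpa using hl0 k
      simp only [div_eq_mul_inv]
      rw [lintegral_mul_const' _ _ h2, ← div_eq_mul_inv _ (ENNReal.ofReal (l k)),
        ENNReal.le_div_iff_mul_le (Or.inl (by simpa using hl0 k)) (Or.inl ENNReal.ofReal_ne_top),
        ← ENNReal.ofReal_mul' (hl0 k).le]
      refine (ENNReal.ofReal_le_ofReal ?_).trans h1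
      have h3 : (h - (h + q) * (l k)⁻¹) * l k = h * (l k - 1) - q := by
        have := (hl0 k).ne'
        field_simp
        ring
      rw [h3]
      have h4 := (Nat.lt_floor_add_one (l k)).le
      gcongr
      linarith
    _ ≤ _ := hfatou
    _ ≤ _ := by
      refine lintegral_mono fun f => ?_
      rw [pointComplexity, ← limsup_nat_add (fun k => S.windowComplexity K τ (ε / 4) (a k) (b k) f /
        ENNReal.ofReal (b k - a k)) k₀]
      refine limsup_le_limsup (Eventually.of_forall fun k => ENNReal.div_le_div_right ?_ _)
      refine (hVW k f).trans (windowComplexity_mono le_rfl (by linarith [hL' k]) ?_ τ f)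
      have := hLl k
      simp only [hl] at this
      linarith

/-- The upper topological entropy is approached by the complexities of invariant measures. -/
theorem upperTopEntropy_le_iSup_measureComplexity (hA1 : S.WindowsCompact) (hA2 : S.BallsGlue)
    (hA3 : S.SeparationBound) (hH1 : K.Concat) (hH3 : K.Shannon) (hH4 : K.Counting) {τ : ℝ}
    (hτ : 0 < τ) {a b : ℕ → ℝ} (hab : AdmissibleWindows a b) :
    S.upperTopEntropy ≤
      ⨆ (μ : Measure S.State) (_ : IsProbabilityMeasure μ) (_ : S.IsInvariant μ),
        S.measureComplexity K τ a b μ := by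
  refine le_of_forall_lt fun x hx => ?_
  obtain ⟨c, hxc, hcx⟩ := ENNReal.lt_iff_exists_nnreal_btwn.1 hx
  refine hxc.trans_le ?_
  have hc0 : (0 : ℝ) < c := by
    have : (0 : ℝ≥0∞) < c := bot_le.trans_lt hxc
    exact_mod_cast this
  rw [← ENNReal.ofReal_coe_nnreal] at hcx ⊢
  obtain ⟨q, hq0, hq⟩ := hA2.exists_gluesWith
  obtain ⟨ε, μ, hε, hprob, hinv, hcost⟩ :=
    exists_invariant_measure_cost_le hA1 hA3 hq hq0 hτ hc0 hcx
  refine le_iSup_of_le μ (le_iSup₂_of_le hprob hinv ?_)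
  have hbound : CostBound S μ τ ε (c * τ) (Real.logb 2 q) := hcost
  have h1 := hbound.le_lintegral_pointComplexity (K := K) hA1 hA2 hA3 hH1 hH3 hH4 hε
    (by positivity) hab
  rw [measureComplexity, ENNReal.le_div_iff_mul_le (Or.inl (by simpa using hτ))
    (Or.inl ENNReal.ofReal_ne_top), ← ENNReal.ofReal_mul hc0.le]
  exact h1.trans (le_iSup₂_of_le (ε / 4) (by linarith) le_rfl)

theorem lowerTopEntropy_le_upperTopEntropy : S.lowerTopEntropy ≤ S.upperTopEntropy := by
  -- Windows of every positive length exist; nontriviality of the filter is what lets the lower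
  -- limit be compared with the upper one.
  have : NeBot windowsToInfinity := by
    refine comap_neBot fun s hs => ?_
    obtain ⟨x, hx⟩ := Filter.nonempty_of_mem hs
    exact ⟨(0, x), by simpa using hx⟩
  refine iSup₂_mono fun ε _ => (liminf_le_limsup (by isBoundedDefault)
    (by isBoundedDefault)).trans (limsup_le_limsup (Eventually.of_forall fun Λ => ?_))
  exact ENNReal.div_le_div_right (liminf_le_limsup (by isBoundedDefault) (by isBoundedDefault)) _

end ExtendedSystem

/-! ### Equality of the supremum with both entropies -/

theorem theorem2 (S : ExtendedSystem)
    (hA1 : S.WindowsCompact) (hA2 : S.BallsGlue) (hA3 : S.SeparationBound)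
    (K : ComplexityFunction)
    (hH1 : K.Concat) (hH2 : K.Projection) (hH3 : K.Shannon) (hH4 : K.Counting)
    (τ : ℝ) (hτ : 0 < τ) (a b : ℕ → ℝ) (hab : AdmissibleWindows a b) :
    (⨆ (μ : Measure S.State) (_ : IsProbabilityMeasure μ) (_ : S.IsInvariant μ),
        S.measureComplexity K τ a b μ) = S.upperTopEntropy ∧
    (⨆ (μ : Measure S.State) (_ : IsProbabilityMeasure μ) (_ : S.IsInvariant μ),
        S.measureComplexity K τ a b μ) = S.lowerTopEntropy := by
  have h1 : (⨆ (μ : Measure S.State) (_ : IsProbabilityMeasure μ) (_ : S.IsInvariant μ),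
      S.measureComplexity K τ a b μ) ≤ S.lowerTopEntropy :=
    iSup_le fun μ => iSup₂_le fun _ _ =>
      ExtendedSystem.measureComplexity_le_lowerTopEntropy hA2 hH1 hH3 hτ hab μ
  have h2 : S.upperTopEntropy ≤ _ :=
    ExtendedSystem.upperTopEntropy_le_iSup_measureComplexity hA1 hA2 hA3 hH1 hH3 hH4 hτ hab
  have h3 := S.lowerTopEntropy_le_upperTopEntropy
  exact ⟨le_antisymm (h1.trans h3) h2, le_antisymm h1 (h3.trans h2)⟩
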